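/- Let $d\ge 2$ and $n\ge 0$ be integers. There is a constant $c=c(d,n)$, depending only on $d$ and $n$, with the following property. Let $\mathbb F_q$ be a finite field of characteristic $p>d$, let $C$ be a smooth projective geometrically integral curve over $\mathbb F_q$ of genus $g$, let $\infty\in C(\mathbb F_q)$, and let $L$ be a line bundle on $C$ of degree $e$. Let $f\in\mathbb F_q[x_1,\dots,x_{n+1}]$ be a form of degree $d$ defining a smooth hypersurface in $\mathbb P^n$; write $f=\sum_{j_1,\dots,j_d=1}^{n+1}a_{j_1,\dots,j_d}x_{j_1}\cdots x_{j_d}$ with $a_{j_1,\dots,j_d}\in\mathbb F_q$ symmetric in the indices, and put $$\Psi_j(x^{(1)},\dots,x^{(d-1)})=d!\sum_{j_1,\dots,j_{d-1}=1}^{n+1}a_{j_1,\dots,j_{d-1},j}\,x^{(1)}_{j_1}\cdots x^{(d-1)}_{j_{d-1}}\qquad(1\le j\le n+1).$$ Let $\alpha$ be an $\mathbb F_q$-linear functional on $H^0(C,L^{\otimes d})$, and let $Z\subset C$ be a finite closed subscheme through which $\alpha$ factors minimally, i.e. $\alpha$ factors through the restriction map $H^0(C,L^{\otimes d})\to H^0(Z,L^{\otimes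 d}|_Z)$ but not through the restriction map to any proper closed subscheme of $Z$. Set $$s=\max\left(\left\lfloor\frac{\deg Z-e+2g-2}{d-1}\right\rfloor,\ \left\lfloor e-\frac{\deg Z}{d-1}\right\rfloor,\ 2g-2,\ 1\right)+1,$$ and let $N_s(\alpha)$ be the number of tuples $(x^{(1)},\dots,x^{(d-1)})\in\bigl(H^0(C,L(-s\infty))^{n+1}\bigr)^{d-1}$ such that $\alpha\bigl(\Psi_j(x^{(1)},\dots,x^{(d-1)})\,y\bigr)=0$ for all $1\le j\le n+1$ and all $y\in H^0\bigl(C,L((d-1)s\infty)\bigr)$. Then $$N_s(\alpha)\le c\cdot q^{(d-2)(n+1)\,h^0(C,L(-s\infty))}.$$ -/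

import Mathlib

open AlgebraicGeometry CategoryTheory IsLocalRing
open scoped TensorProduct

universe u

noncomputable section

/-! ### Local rings of smooth curves -/

/-- The local rings of a standard smooth algebra of relative dimension one over a perfect field
have at most one-dimensional cotangent spaces. -/
theorem finrank_cotangentSpace_le_one (B A R : Type*) [Field B] [PerfectField B] [CommRing A]
    [CommRing R] [IsLocalRing R] [Algebra B A] [Algebra A R] [Algebra B R] [IsScalarTower B A R]
    [IsNoetherianRing R] [Algebra.IsStandardSmoothOfRelativeDimension 1 B A]
    (p : Ideal A) [p.IsPrime] [IsLocalization.AtPrime R p] :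
    Module.finrank (ResidueField R) (CotangentSpace R) ≤ 1 := by
  have : Nontrivial A := (algebraMap A R).domain_nontrivial
  have : Algebra.IsStandardSmooth B A :=
    Algebra.IsStandardSmoothOfRelativeDimension.isStandardSmooth 1
  have h1 : Module.finrank A (Ω[A⁄B]) = 1 := by
    have := Algebra.IsStandardSmoothOfRelativeDimension.rank_kaehlerDifferential
      (R := B) (S := A) 1
    exact Module.finrank_eq_of_rank_eq (by exact_mod_cast this)
  have : Module.Free A (Ω[A⁄B]) := inferInstance
  have h2 : Module.finrank R (Ω[R⁄B]) = 1 := by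
    rw [Module.finrank_of_isLocalizedModule_of_free R p.primeCompl
      (KaehlerDifferential.map B B A R), h1]
  have : Module.Free R (Ω[R⁄B]) :=
    Module.free_of_isLocalizedModule p.primeCompl (KaehlerDifferential.map B B A R)
  have : Module.Finite R (Ω[R⁄B]) := Module.finite_of_finrank_eq_succ h2
  have h3 : Module.finrank (ResidueField R) (ResidueField R ⊗[R] (Ω[R⁄B])) = 1 := by
    rw [Module.finrank_baseChange, h2]
  have : Algebra.EssFiniteType A R := Algebra.EssFiniteType.of_isLocalization R p.primeCompl
  have : Algebra.EssFiniteType B R := Algebra.EssFiniteType.comp B A R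
  have : Algebra.EssFiniteType B (ResidueField R) := Algebra.EssFiniteType.comp B R _
  have hk : Algebra.FormallySmooth B (ResidueField R) := inferInstance
  have : Algebra.FormallySmooth A R := Algebra.FormallySmooth.of_isLocalization p.primeCompl
  have : Algebra.FormallySmooth B R := Algebra.FormallySmooth.comp B A R
  have hs : Function.Surjective (algebraMap R (ResidueField R)) := residue_surjective
  have hex : ∃ f : (maximalIdeal R).Cotangent →ₗ[R] ResidueField R ⊗[R] (Ω[R⁄B]),
      Function.Injective f := by
    have h : RingHom.ker (algebraMap R (ResidueField R)) = maximalIdeal R := ker_residue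
    rw [← h]
    obtain ⟨l, hl⟩ := (Algebra.FormallySmooth.iff_split_injection hs).mp hk
    exact ⟨_, LinearMap.injective_of_comp_eq_id _ l hl⟩
  obtain ⟨f, hf⟩ := hex
  have := LinearMap.finrank_le_finrank_of_injective (R := ResidueField R)
    (f := LinearMap.extendScalarsOfSurjective hs (M := CotangentSpace R) f) hf
  omega

/-- The local rings of an integral scheme that is smooth of relative dimension one over a finite
field are principal ideal domains. -/
theorem isPrincipalIdealRing_stalk {k : Type u} [Field k] [Finite k] {X : Scheme.{u}}
    (π : X ⟶ Spec (.of k)) [IsIntegral X] [IsLocallyNoetherian X]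
    [SmoothOfRelativeDimension 1 π] (x : X) : IsPrincipalIdealRing (X.presheaf.stalk x) := by
  obtain ⟨U, hU, V, hV, hx, e, hf⟩ :=
    SmoothOfRelativeDimension.exists_isStandardSmoothOfRelativeDimension (n := 1) (f := π) x
  have hUtop : U = ⊤ := by
    rw [eq_top_iff]
    rintro y -
    have : y = π x := Subsingleton.elim _ _
    exact this ▸ e hx
  subst hUtop
  let eB : k ≃+* Γ(Spec (.of k), ⊤) :=
    (Scheme.ΓSpecIso (.of k)).symm.commRingCatIsoToRingEquiv
  let fB : Field Γ(Spec (.of k), ⊤) := (eB.symm.toMulEquiv.isField (Field.toIsField k)).toField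
  have : Finite Γ(Spec (.of k), ⊤) := Finite.of_equiv k eB.toEquiv
  algebraize [(π.appLE ⊤ V e).hom]
  have : Nonempty V := ⟨⟨x, hx⟩⟩
  let := TopCat.Presheaf.algebra_section_stalk X.presheaf ⟨x, hx⟩
  have := hV.isLocalization_stalk ⟨x, hx⟩
  let : Algebra Γ(Spec (.of k), ⊤) (X.presheaf.stalk x) :=
    ((algebraMap Γ(X, V) (X.presheaf.stalk x)).comp (π.appLE ⊤ V e).hom).toAlgebra
  have : IsScalarTower Γ(Spec (.of k), ⊤) Γ(X, V) (X.presheaf.stalk x) :=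
    IsScalarTower.of_algebraMap_eq' rfl
  have key := finrank_cotangentSpace_le_one Γ(Spec (.of k), ⊤) Γ(X, V) (X.presheaf.stalk x)
    (hV.primeIdealOf ⟨x, hx⟩).asIdeal
  exact ((tfae_of_isNoetherianRing_of_isLocalRing_of_isDomain (X.presheaf.stalk x)).out 5 0).mp key

/-- The order of vanishing satisfies the ultrametric inequality on a smooth curve. -/
theorem min_ord_le_ord_add {k : Type u} [Field k] [Finite k] {X : Scheme.{u}}
    (π : X ⟶ Spec (.of k)) [IsIntegral X] [IsLocallyNoetherian X]
    [SmoothOfRelativeDimension 1 π] (x : X) {f g : X.functionField} (hfg : f + g ≠ 0) :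
    min (X.ord f x) (X.ord g x) ≤ X.ord (f + g) x := by
  by_cases hx : Order.coheight x = 1
  · have := isPrincipalIdealRing_stalk π x
    have : IsDiscreteValuationRing (X.presheaf.stalk x) := by
      refine { not_a_field' := fun h => ?_ }
      have hd := ringKrullDim_stalk_eq_coheight x
      rw [ringKrullDim_eq_zero_of_isField (isField_iff_maximalIdeal_eq.mpr h), hx] at hd
      simp at hd
    exact Scheme.ord_add hfg
  · simp [hx]

/-! ### Curves and divisors -/

/-- A smooth projective (geometrically integral) curve over the field `k`. Since it is proper and
one-dimensional, such a scheme is automatically projective. -/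
structure SmoothProjectiveCurve (k : Type u) [Field k] where
  /-- the underlying scheme -/
  X : Scheme.{u}
  /-- the structure morphism -/
  π : X ⟶ Spec (.of k)
  proper : IsProper π
  smooth : SmoothOfRelativeDimension 1 π
  geometricallyIntegral : GeometricallyIntegral π

namespace SmoothProjectiveCurve

variable {k : Type u} [Field k] (C : SmoothProjectiveCurve k)

instance : IsProper C.π := C.proper
instance : SmoothOfRelativeDimension 1 C.π := C.smooth
instance : GeometricallyIntegral C.π := C.geometricallyIntegral
instance : IsIntegral C.X := GeometricallyIntegral.isIntegral_of_subsingleton C.π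
instance : IsLocallyNoetherian C.X := LocallyOfFiniteType.isLocallyNoetherian C.π

/-- The function field `k(C)`. -/
abbrev K : Type u := C.X.functionField

instance : Nonempty (⊤ : C.X.Opens) := ⟨⟨genericPoint C.X, trivial⟩⟩

/-- The function field of `C` as an extension of `k`, through `k → Γ(C, 𝒪_C) → k(C)`. -/
instance : Algebra k C.K :=
  ((C.X.germToFunctionField ⊤).hom.comp
    ((Scheme.ΓSpecIso (.of k)).inv ≫ C.π.appTop).hom).toAlgebra

/-- The closed points of `C`. -/
abbrev ClosedPoint : Type u := {x : C.X // IsClosed ({x} : Set C.X)}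

/-- The degree `[κ(x) : k]` of a closed point. -/
def pointDegree (x : C.ClosedPoint) : ℕ := C.π.residueDegree x.1

/-- Divisors on `C`. -/
abbrev Divisor : Type u := C.ClosedPoint →₀ ℤ

variable {C}

/-- The degree of a divisor. -/
def Divisor.deg (D : C.Divisor) : ℤ := D.sum fun x n => n * C.pointDegree x

theorem ord_algebraMap (c : k) (x : C.X) : C.X.ord (algebraMap k C.K c) x = 0 := by
  by_cases hc : c = 0
  · simp [hc]
  · have hu : IsUnit (((Scheme.ΓSpecIso (.of k)).inv ≫ C.π.appTop).hom c) :=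
      (Ne.isUnit hc).map ((Scheme.ΓSpecIso (.of k)).inv ≫ C.π.appTop).hom
    exact Scheme.ord_of_isUnit (X := C.X) (U := ⊤) hu (x := x) trivial

variable [Finite k]

/-- The stalk `𝒪_C(D)_x` inside the function field: the rational functions `f` with `f = 0` or
`ord_x f ≥ -D(x)`. -/
def localSections (D : C.Divisor) (x : C.ClosedPoint) : Submodule k C.K where
  carrier := {f | f = 0 ∨ 0 ≤ C.X.ord f x.1 + D x}
  zero_mem' := Or.inl rfl
  add_mem' := by
    intro f g hf hg
    by_cases hfg : f + g = 0
    · exact Or.inl hfg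
    rcases hf with rfl | hf
    · simpa using hg
    rcases hg with rfl | hg
    · exact Or.inr (by simpa using hf)
    have := min_ord_le_ord_add C.π x.1 hfg
    refine Or.inr ?_
    rcases min_le_iff.mp this with h | h <;> linarith
  smul_mem' := by
    intro c f hf
    rcases hf with rfl | hf
    · exact Or.inl (smul_zero c)
    by_cases h : c • f = 0
    · exact Or.inl h
    rw [Algebra.smul_def] at h ⊢
    obtain ⟨h1, h2⟩ := mul_ne_zero_iff.mp h
    exact Or.inr (by rw [Scheme.ord_mul h1 h2, ord_algebraMap, zero_add]; exact hf)

/-- The global sections `H⁰(C, 𝒪_C(D))`. -/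
def H0 (D : C.Divisor) : Submodule k C.K := ⨅ x, localSections D x

/-- `h⁰(C, 𝒪_C(D))`. -/
def h0 (D : C.Divisor) : ℕ := Module.finrank k (H0 D)

theorem mul_mem_H0 {D E : C.Divisor} {f g : C.K} (hf : f ∈ H0 D) (hg : g ∈ H0 E) :
    f * g ∈ H0 (D + E) := by
  simp only [H0, Submodule.mem_iInf] at hf hg ⊢
  intro x
  by_cases h : f * g = 0
  · exact Or.inl h
  obtain ⟨h1, h2⟩ := mul_ne_zero_iff.mp h
  have h3 := (hf x).resolve_left h1
  have h4 := (hg x).resolve_left h2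
  refine Or.inr ?_
  rw [Scheme.ord_mul h1 h2, Finsupp.add_apply]
  linarith

theorem one_mem_H0 : (1 : C.K) ∈ H0 (0 : C.Divisor) := by
  simp only [H0, Submodule.mem_iInf]
  intro x
  refine Or.inr ?_
  rw [← map_one (algebraMap k C.K), ord_algebraMap]
  simp

theorem prod_mem_H0 {D : C.Divisor} {m : ℕ} {f : Fin m → C.K} (hf : ∀ i, f i ∈ H0 D) :
    ∏ i, f i ∈ H0 (m • D) := by
  induction m with
  | zero => simpa using one_mem_H0
  | succ m ih =>
    rw [Fin.prod_univ_succ, succ_nsmul']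
    exact mul_mem_H0 (hf 0) (ih fun i => hf i.succ)

/-! ### The genus -/

variable (C) in
/-- The adeles (repartitions) of `k(C)`: families of rational functions indexed by the closed
points, almost all of whose members are regular at the corresponding point. -/
def adeles : Submodule k (C.ClosedPoint → C.K) where
  carrier := {r | {x | r x ∉ localSections (0 : C.Divisor) x}.Finite}
  zero_mem' := by simp
  add_mem' := by
    intro r s hr hs
    refine (Set.Finite.union hr hs).subset fun x hx => ?_
    by_contra h
    simp only [Set.mem_union, Set.mem_ofPred_eq, not_or, not_not] at h
    exact hx (add_mem h.1 h.2)
  smul_mem' := by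
    intro c r hr
    exact Set.Finite.subset hr fun x hx h => hx (Submodule.smul_mem _ c h)

/-- The adeles `r` with `ord_x (r x) ≥ -D(x)` for all closed points `x`. -/
def adelesOf (D : C.Divisor) : Submodule k (C.ClosedPoint → C.K) :=
  Submodule.pi Set.univ (localSections D)

variable (C) in
/-- The principal adeles: the function field, embedded diagonally. -/
def principalAdeles : Submodule k (C.ClosedPoint → C.K) :=
  LinearMap.range (LinearMap.pi fun _ => LinearMap.id : C.K →ₗ[k] C.ClosedPoint → C.K)

/-- The cohomology group `H¹(C, 𝒪_C(D))` as the quotient of the adeles by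
the sum of the adeles of `D` and the principal adeles. -/
abbrev H1 (D : C.Divisor) : Type u :=
  adeles C ⧸ (adelesOf D ⊔ principalAdeles C).submoduleOf (adeles C)

variable (C) in
/-- The genus `g = dim H¹(C, 𝒪_C)`. -/
def genus : ℕ := Module.finrank k (H1 (0 : C.Divisor))

/-! ### Linear functionals factoring through closed subschemes -/

/-- The space `H⁰(Z, 𝒪_C(D)|_Z)` for the finite closed subscheme `Z` given by an effective divisor:
the product over the closed points `x` of the quotients `𝒪_C(D)_x / 𝒪_C(D - Z)_x`. -/
abbrev sectionsOn (D Z : C.Divisor) : Type u :=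
  ∀ x : C.ClosedPoint, localSections D x ⧸ (localSections (D - Z) x).submoduleOf (localSections D x)

/-- The restriction map `H⁰(C, 𝒪_C(D)) → H⁰(Z, 𝒪_C(D)|_Z)`. -/
def restrict (D Z : C.Divisor) : H0 D →ₗ[k] sectionsOn D Z :=
  LinearMap.pi fun x => Submodule.mkQ _ ∘ₗ Submodule.inclusion (iInf_le (localSections D) x)

/-- `α ∼ Z`: the linear functional `α` on `H⁰(C, 𝒪_C(D))` factors through the restriction
map to `Z`. -/
def FactorsThrough {D : C.Divisor} (α : Module.Dual k (H0 D)) (Z : C.Divisor) : Prop :=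
  ∃ β : Module.Dual k (sectionsOn D Z), α = β ∘ₗ restrict D Z

/-- `α ∼_min Z`: the functional `α` factors through the finite closed subscheme `Z`, and through
no proper closed subscheme of `Z`. -/
def FactorsMinimally {D : C.Divisor} (α : Module.Dual k (H0 D)) (Z : C.Divisor) : Prop :=
  0 ≤ Z ∧ FactorsThrough α Z ∧ ∀ Z' : C.Divisor, 0 ≤ Z' → Z' < Z → ¬ FactorsThrough α Z'

/-! ### The multilinear forms and the counting function -/

/-- Given the coefficients `a` of a form `∑ a_{j₁,…,j_d} x_{j₁} ⋯ x_{j_d}`, with `a` symmetric,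
the multilinear form
`Ψ_j(x⁽¹⁾, …, x⁽ᵈ⁻¹⁾) = d! ∑ a_{j₁,…,j_{d-1},j} x⁽¹⁾_{j₁} ⋯ x⁽ᵈ⁻¹⁾_{j_{d-1}}`. -/
def Psi {n d : ℕ} (a : (Fin d → Fin (n + 1)) → k) (j : Fin (n + 1))
    (x : Fin (d - 1) → Fin (n + 1) → C.K) : C.K :=
  (d.factorial : C.K) * ∑ J : Fin (d - 1) → Fin (n + 1),
    algebraMap k C.K (a fun i => if h : i.1 < d - 1 then J ⟨i.1, h⟩ else j) * ∏ i, x i (J i)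

theorem Psi_mem_H0 {n d : ℕ} (a : (Fin d → Fin (n + 1)) → k) (j : Fin (n + 1)) {D : C.Divisor}
    (x : Fin (d - 1) → Fin (n + 1) → H0 D) :
    Psi a j (fun i l => (x i l : C.K)) ∈ H0 ((d - 1) • D) := by
  rw [Psi, ← nsmul_eq_mul]
  refine nsmul_mem (sum_mem fun J _ => ?_) _
  rw [← Algebra.smul_def]
  exact Submodule.smul_mem _ _ (prod_mem_H0 fun i => (x i (J i)).2)

theorem Psi_mul_mem_H0 {n d : ℕ} (hd : 1 ≤ d) (a : (Fin d → Fin (n + 1)) → k) (j : Fin (n + 1))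
    {D E : C.Divisor} (x : Fin (d - 1) → Fin (n + 1) → H0 (D - E)) (y : H0 (D + (d - 1) • E)) :
    Psi a j (fun i l => (x i l : C.K)) * y ∈ H0 (d • D) := by
  have h := mul_mem_H0 (Psi_mem_H0 a j x) y.2
  have e : (d - 1) • (D - E) + (D + (d - 1) • E) = d • D := by
    obtain ⟨m, rfl⟩ := Nat.exists_eq_add_of_le' hd
    rw [Nat.add_sub_cancel, smul_sub, succ_nsmul]
    abel
  rwa [e] at h

/-- The number `N_s(α)` of tuples `(x⁽¹⁾, …, x⁽ᵈ⁻¹⁾)` of elements of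
`H⁰(C, L(-s∞))ⁿ⁺¹` such that `α(Ψ_j(x⁽¹⁾, …, x⁽ᵈ⁻¹⁾) y) = 0` for all `j` and all
`y ∈ H⁰(C, L((d-1)s∞))`, where `L = 𝒪_C(D)` and `α` is a functional on `H⁰(C, L^{⊗d})`. -/
def countN {n d : ℕ} (hd : 1 ≤ d) (a : (Fin d → Fin (n + 1)) → k) (D : C.Divisor)
    (infty : C.ClosedPoint) (s : ℤ) (α : Module.Dual k (H0 (d • D))) : ℕ :=
  Nat.card {x : Fin (d - 1) → Fin (n + 1) → H0 (D - Finsupp.single infty s) //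
    ∀ (j : Fin (n + 1)) (y : H0 (D + (d - 1) • Finsupp.single infty s)),
      α ⟨Psi a j (fun i l => (x i l : C.K)) * y, Psi_mul_mem_H0 hd a j x y⟩ = 0}

/-- The shrinking parameter
`s = max(⌊(deg Z - e + 2g - 2)/(d - 1)⌋, ⌊e - deg Z/(d - 1)⌋, 2g - 2, 1) + 1`. -/
def shrinkingParameter (d : ℕ) (e g degZ : ℤ) : ℤ :=
  max (max ⌊((degZ - e + 2 * g - 2 : ℤ) : ℚ) / ((d : ℚ) - 1)⌋
    ⌊(e : ℚ) - (degZ : ℚ) / ((d : ℚ) - 1)⌋) (max (2 * g - 2) 1) + 1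

end SmoothProjectiveCurve

/-! ### Smooth hypersurfaces -/

/-- The homogeneous form `f` of degree `d` defines a smooth hypersurface in `ℙⁿ`: over the algebraic
closure, `f` and its partial derivatives have no common zero other than the origin. -/
def IsSmoothHypersurface {k : Type u} [Field k] {n : ℕ} (f : MvPolynomial (Fin (n + 1)) k)
    (d : ℕ) : Prop :=
  f.IsHomogeneous d ∧ ∀ x : Fin (n + 1) → AlgebraicClosure k, MvPolynomial.aeval x f = 0 →
    (∀ i, MvPolynomial.aeval x (MvPolynomial.pderiv i f) = 0) → x = 0

/-- `a` is the symmetric family of coefficients in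
`f = ∑_{j₁,…,j_d} a_{j₁,…,j_d} x_{j₁} ⋯ x_{j_d}`. -/
def IsSymmetricCoefficients {k : Type u} [Field k] {n d : ℕ} (f : MvPolynomial (Fin (n + 1)) k)
    (a : (Fin d → Fin (n + 1)) → k) : Prop :=
  (∀ (σ : Equiv.Perm (Fin d)) (J : Fin d → Fin (n + 1)), a (J ∘ σ) = a J) ∧
    f = ∑ J : Fin d → Fin (n + 1), MvPolynomial.C (a J) * ∏ i, MvPolynomial.X (J i)

end

noncomputable section

/-! ### Zeros of polynomial systems with a nondegenerate leading part -/

namespace MvPolynomial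

variable {K : Type*} [Field K] {σ τ : Type*}

/-! The choice of `s` makes every counted tuple an honest zero of the multilinear system over the
function field, and those zeros are counted by slicing along translates of the diagonal.

Forcing zeros. Put F = (d-1)(D - s∞) and E = D + (d-1)s∞, so F + E = dD, and let u = Ψ_j(x) ∈ H⁰(F)
with α(uy) = 0 for all y ∈ H⁰(E). Let W ≤ Z be the part of Z on which u vanishes. The first entry of
the maximum defining `s` gives deg(E - Z) > 2g - 2, hence H¹(E - Z) = 0; so any section of dD
vanishing on W agrees modulo Z with some uy, and α kills it. Thus α factors through W, and
minimality gives W = Z. The second entry gives deg(F - Z) < 0, so u, a section of F - Z, is zero.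
This is `eq_zero_of_forall_mul_eq_zero`.

Counting zeros. Let V = H⁰(D - s∞). Fixing the d - 2 differences of the vectors x⁽ⁱ⁾ leaves
|V|^((d-2)(n+1)) slices. Each slice is a system of n + 1 polynomials of degree d - 1 in n + 1
unknowns, whose leading forms are the partial derivatives of f up to the factor d, invertible since
p > d. By smoothness and the Nullstellensatz these forms generate an ideal containing powers of all
variables, which bounds the number of solutions in terms of d and n alone (`card_zeros_le`,
`card_multilinear_zeros_le`).

Cohomology. With H¹ defined by adeles, the inputs are: H¹ is finite dimensional
(`exists_adeles_le`), adding a point changes the Euler characteristic by its degree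
(`finrank_add_single`), and H⁰ vanishes in negative degree, H¹ in degree above 2g - 2
(`H0_eq_bot_of_deg_neg`, `subsingleton_H1`). Both vanishing statements follow from multiplication by
sections, without Serre duality. -/

theorem homogeneousComponent_mul_of_isHomogeneous {p q : MvPolynomial σ K} {m n : ℕ}
    (hq : q.IsHomogeneous m) (h : m ≤ n) :
    homogeneousComponent n (p * q) = homogeneousComponent (n - m) p * q := by
  classical
  conv_lhs => rw [← sum_homogeneousComponent p, Finset.sum_mul, map_sum]
  have h1 : ∀ i, homogeneousComponent n (homogeneousComponent i p * q) =
      if i = n - m then homogeneousComponent (n - m) p * q else 0 := by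
    intro i
    rw [homogeneousComponent_of_mem ((homogeneousComponent_isHomogeneous i p).mul hq)]
    by_cases hi : i = n - m
    · subst hi
      rw [if_pos (by omega), if_pos rfl]
    · rw [if_neg (by omega), if_neg hi]
  rw [Finset.sum_congr rfl fun i _ => h1 i, Finset.sum_ite_eq']
  split_ifs with h2
  · rfl
  · rw [homogeneousComponent_eq_zero _ _ (by rw [Finset.mem_range] at h2; omega), zero_mul]

variable [Fintype τ]

/-- If a power of `X i` lies in the ideal generated by forms of degree `m`, then some power is a
combination of these forms with coefficients of controlled degree. -/
theorem exists_pow_eq_sum_mul {G : τ → MvPolynomial σ K} {m : ℕ}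
    (hG : ∀ j, (G j).IsHomogeneous m) {i : σ}
    (h : X i ∈ (Ideal.span (Set.range G)).radical) :
    ∃ N, m ≤ N ∧ ∃ b : τ → MvPolynomial σ K, (∀ j, (b j).totalDegree ≤ N - m) ∧
      X i ^ N = ∑ j, b j * G j := by
  obtain ⟨N, hN⟩ := h
  -- The exponent is raised by `m` so that the subtraction in `N - m` is not truncated. Taking the
  -- component of degree `N + m` of the relation then replaces the coefficients by forms of the
  -- right degree.
  have hN' : X i ^ (N + m) ∈ Ideal.span (Set.range G) := by
    rw [pow_add]
    exact Ideal.mul_mem_right _ _ hN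
  obtain ⟨b, hb⟩ := Ideal.mem_span_range_iff_exists_fun.mp hN'
  refine ⟨N + m, by omega, fun j => homogeneousComponent (N + m - m) (b j),
    fun j => (homogeneousComponent_isHomogeneous _ _).totalDegree_le, ?_⟩
  have h1 : homogeneousComponent (N + m) (X i ^ (N + m) : MvPolynomial σ K) = X i ^ (N + m) :=
    homogeneousComponent_eq_self (isHomogeneous_X_pow i _)
  rw [← h1, ← hb, map_sum]
  exact Finset.sum_congr rfl fun j _ =>
    homogeneousComponent_mul_of_isHomogeneous (hG j) (by omega)

variable [Fintype σ]

/-- If the leading forms of the `F j` generate an ideal containing powers of all variables, then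
the polynomial ring is integral over the subring generated by the `F j`. -/
theorem isIntegral_aeval_of_leadingForms {G F : τ → MvPolynomial σ K} {m : ℕ} (hm : 0 < m)
    (hG : ∀ j, (G j).IsHomogeneous m) (hF : ∀ j, (F j - G j).totalDegree < m)
    (h : ∀ i, X i ∈ (Ideal.span (Set.range G)).radical) :
    (aeval F : MvPolynomial τ K →ₐ[K] MvPolynomial σ K).IsIntegral := by
  classical
  choose N hmN b hb hN using fun i => exists_pow_eq_sum_mul hG (h i)
  set M := ∑ i, N i with hM
  set B : Subalgebra K (MvPolynomial σ K) := (aeval F : MvPolynomial τ K →ₐ[K] _).range with hB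
  let S : Set (MvPolynomial σ K) :=
    (fun s : σ → Fin (M + 1) => monomial (Finsupp.equivFunOnFinite.symm fun i => (s i : ℕ)) 1) ''
      Set.univ
  have hS : S.Finite := Set.finite_univ.image _
  set W : Submodule B (MvPolynomial σ K) := Submodule.span B S with hW
  have hFB : ∀ j (p : MvPolynomial σ K), p ∈ W → F j * p ∈ W := fun j p hp => by
    have : F j ∈ B := ⟨X j, by simp⟩
    exact W.smul_mem (⟨F j, this⟩ : B) hp
  have hC : ∀ (c : K) (p : MvPolynomial σ K), p ∈ W → C c * p ∈ W := fun c p hp => by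
    have : (C c : MvPolynomial σ K) ∈ B := ⟨C c, by simp⟩
    exact W.smul_mem (⟨C c, this⟩ : B) hp
  have hdegree : ∀ s : σ →₀ ℕ, s.degree = s.sum fun _ e => e := fun s => by
    rw [Finsupp.degree_eq_sum, Finsupp.sum_fintype _ _ (fun _ => rfl)]
  -- Induction on degree. A monomial with some exponent at least `N i` contains X_i^(N i) = Σ b_ij
  -- G_j. Writing G_j = F_j - (F_j - G_j), the first part is F_j ∈ B times something of degree lower
  -- by `m`, and the second has lower degree because F_j - G_j has degree below `m`. Hence the
  -- monomials with exponents at most `M` span over `B`.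
  have key : ∀ t, ∀ p : MvPolynomial σ K, p.totalDegree < t → p ∈ W := by
    intro t
    induction t with
    | zero => intro p hp; omega
    | succ t ih =>
      intro p hp
      rw [p.as_sum]
      refine Submodule.sum_mem _ fun s hs => ?_
      rw [← mul_one (coeff s p), ← C_mul_monomial]
      refine hC _ _ ?_
      have hst : s.degree ≤ t := by
        have h1 := le_totalDegree hs
        rw [← hdegree] at h1
        omega
      by_cases hsM : ∀ i, s i < M + 1
      · refine Submodule.subset_span ⟨fun i => ⟨s i, hsM i⟩, trivial, ?_⟩
        ext i
        simp
      · push Not at hsM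
        obtain ⟨i, hi⟩ := hsM
        have hNi : N i ≤ s i := by
          have : N i ≤ M := Finset.single_le_sum (f := N) (fun _ _ => Nat.zero_le _)
            (Finset.mem_univ i)
          omega
        set s' := s - Finsupp.single i (N i) with hs'
        have hss : s = Finsupp.single i (N i) + s' := by
          rw [hs', add_tsub_cancel_of_le]
          simpa using hNi
        have hdeg : s.degree = N i + s'.degree := by
          conv_lhs => rw [hss]
          simp [map_add]
        have e1 : monomial s (1 : K) = X i ^ N i * monomial s' 1 := by
          rw [X_pow_eq_monomial, monomial_mul, ← hss, mul_one]
        have e2 : monomial s (1 : K) = ∑ j, (F j * (b i j * monomial s' 1) -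
            (F j - G j) * (b i j * monomial s' 1)) := by
          rw [e1, hN i, Finset.sum_mul]
          exact Finset.sum_congr rfl fun j _ => by ring
        rw [e2]
        have hd : ∀ j, (b i j * monomial s' (1 : K)).totalDegree + m ≤ t := fun j => by
          have h1 := totalDegree_mul (b i j) (monomial s' (1 : K))
          have h2 := totalDegree_monomial s' (one_ne_zero (α := K))
          have h3 := hb i j
          have h4 := hmN i
          have h5 := hdegree s'
          omega
        refine Submodule.sum_mem _ fun j _ => W.sub_mem (hFB j _ (ih _ ?_)) (ih _ ?_)
        · have := hd j
          omega
        · have h1 := totalDegree_mul (F j - G j) (b i j * monomial s' (1 : K))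
          have := hd j
          have := hF j
          omega
  have htop : W = ⊤ := eq_top_iff.mpr fun p _ => key _ p (Nat.lt_succ_self _)
  have : Module.Finite B (MvPolynomial σ K) := ⟨⟨hS.toFinset, by simpa using htop⟩⟩
  -- Finiteness gives a monic equation over the subring `B`; its coefficients are lifted to the
  -- polynomial ring in the symbols for the F_j.
  intro p
  obtain ⟨q, hq, hq0⟩ := (IsIntegral.of_finite B p)
  have hsurj : Function.Surjective (aeval F : MvPolynomial τ K →ₐ[K] _).rangeRestrict :=
    AlgHom.rangeRestrict_surjective _
  obtain ⟨q', hq', -, hqm⟩ := Polynomial.lifts_and_degree_eq_and_monic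
    ((Polynomial.lifts_iff_coeff_lifts q (f :=
      (aeval F : MvPolynomial τ K →ₐ[K] _).rangeRestrict.toRingHom)).mpr
        fun n => hsurj (q.coeff n)) hq
  refine ⟨q', hqm, ?_⟩
  rw [← hq', Polynomial.eval₂_map] at hq0
  exact hq0

/-- Polynomials that are integral over as many polynomials as there are variables force the latter
to be algebraically independent. -/
theorem aeval_injective_of_isIntegral {F : τ → MvPolynomial σ K}
    (hcard : Fintype.card τ = Fintype.card σ)
    (h : (aeval F : MvPolynomial τ K →ₐ[K] MvPolynomial σ K).IsIntegral) :
    Function.Injective (aeval F : MvPolynomial τ K →ₐ[K] MvPolynomial σ K) := by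
  have halg : Algebra.IsAlgebraic (Algebra.adjoin K (Set.range F)) (MvPolynomial σ K) := by
    constructor
    intro p
    obtain ⟨q, hq, hq0⟩ := h p
    rw [Algebra.adjoin_range_eq_range_aeval]
    refine IsIntegral.isAlgebraic ⟨q.map (aeval F : MvPolynomial τ K →ₐ[K] _).rangeRestrict.toRingHom,
      hq.map _, ?_⟩
    rw [Polynomial.eval₂_map]
    exact hq0
  have := Algebra.IsAlgebraic.isTranscendenceBasis_of_lift_le_trdeg_of_finite K F (by
    rw [MvPolynomial.trdeg_of_isDomain]
    simp [hcard])
  exact this.1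

/-- The coordinates of the common zeros of a nondegenerate system are roots of a polynomial of
bounded degree. -/
theorem exists_polynomial_of_isIntegral {F : τ → MvPolynomial σ K} {m : ℕ}
    (hF : ∀ j, (F j).totalDegree ≤ m)
    (hinj : Function.Injective (aeval F : MvPolynomial τ K →ₐ[K] MvPolynomial σ K))
    (hint : (aeval F : MvPolynomial τ K →ₐ[K] MvPolynomial σ K).IsIntegral)
    (hcard : Fintype.card τ = Fintype.card σ) (i : σ) :
    ∃ Q : Polynomial K, Q ≠ 0 ∧ Q.natDegree ≤ (Fintype.card σ * m + 1) ^ Fintype.card σ ∧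
      ∀ z : σ → K, (∀ j, aeval z (F j) = 0) → Q.eval (z i) = 0 := by
  classical
  let P := MvPolynomial τ K
  let A := MvPolynomial σ K
  let algPA : Algebra P A := (aeval F : P →ₐ[K] A).toRingHom.toAlgebra
  have : IsScalarTower K P A := IsScalarTower.of_algebraMap_eq fun c => by
    exact ((aeval F : P →ₐ[K] A).commutes c).symm
  have hinj' : Function.Injective (algebraMap P A) := hinj
  have : FaithfulSMul P A := (faithfulSMul_iff_algebraMap_injective P A).mpr hinj'
  have : Module.IsTorsionFree P A := inferInstance
  have hi : IsIntegral P (X i : A) := hint (X i)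
  set f := minpoly P (X i : A) with hf
  have hmon : f.Monic := minpoly.monic hi
  set r := Fintype.card σ
  set M := f.natDegree with hM
  refine ⟨f.map constantCoeff, (hmon.map _).ne_zero, ?_, ?_⟩
  · rw [hmon.natDegree_map, ← hM]
    -- Hilbert function count. The products F^s X_i^b with s_j ≤ M and b < M are linearly
    -- independent over K and have degree at most D = rmM + M, so (M + 1)^r M ≤ (D + 1)^r ≤ (rm +
    -- 1)^r (M + 1)^r.
    by_contra! hlt
    have hli2 : LinearIndependent P fun b : Fin M => (X i : A) ^ (b : ℕ) := by
      rw [Fintype.linearIndependent_iff]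
      intro g hg b
      set p : Polynomial P := ∑ b : Fin M, Polynomial.monomial b (g b) with hp
      have hp0 : p = 0 := by
        by_contra hne
        have h1 := minpoly.IsIntegrallyClosed.degree_le_of_ne_zero (s := (X i : A)) hne (by
          rw [hp, map_sum, ← hg]
          refine Finset.sum_congr rfl fun b _ => ?_
          rw [Polynomial.aeval_monomial, Algebra.smul_def])
        have h2 : p.degree < M := by
          rw [hp]
          refine (Polynomial.degree_sum_le _ _).trans_lt ?_
          refine (Finset.sup_lt_iff (WithBot.bot_lt_coe M)).mpr fun b _ => ?_
          exact (Polynomial.degree_monomial_le _ _).trans_lt (WithBot.coe_lt_coe.mpr b.2)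
        rw [← hf, Polynomial.degree_eq_natDegree hmon.ne_zero] at h1
        exact absurd (h1.trans_lt h2) (lt_irrefl _)
      have := congrArg (fun q => q.coeff b) hp0
      simpa [hp, Polynomial.finsetSum_coeff, Polynomial.coeff_monomial, Fin.val_inj] using this
    have hli1 : LinearIndependent K fun s : τ → Fin (M + 1) =>
        (monomial (Finsupp.equivFunOnFinite.symm fun j => (s j : ℕ)) 1 : P) := by
      have := (basisMonomials τ K).linearIndependent.comp
        (fun s : τ → Fin (M + 1) => Finsupp.equivFunOnFinite.symm fun j => (s j : ℕ))
        (fun s t hst => by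
          ext j
          simpa using DFunLike.congr_fun hst j)
      simpa [Function.comp_def] using this
    have hli := linearIndependent_smul hli1 hli2
    set D := r * m * M + M with hD
    let coeffs : A →ₗ[K] ((σ → Fin (D + 1)) → K) :=
      LinearMap.pi fun s => lcoeff K (Finsupp.equivFunOnFinite.symm fun j => (s j : ℕ))
    have hdeg : ∀ (s : τ → Fin (M + 1)) (b : Fin M),
        ((monomial (Finsupp.equivFunOnFinite.symm fun j => (s j : ℕ)) 1 : P) •
          (X i : A) ^ (b : ℕ)).totalDegree ≤ D := by
      intro s b
      rw [Algebra.smul_def]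
      have e : algebraMap P A (monomial (Finsupp.equivFunOnFinite.symm fun j => (s j : ℕ)) 1) =
          ∏ j, F j ^ (s j : ℕ) := by
        change aeval F (monomial _ 1) = _
        rw [aeval_monomial, Finsupp.prod_fintype _ _ (by simp)]
        simp
      rw [e]
      refine (totalDegree_mul _ _).trans (add_le_add ?_ ?_)
      · refine (totalDegree_finsetProd _ _).trans ?_
        calc ∑ j, (F j ^ (s j : ℕ)).totalDegree ≤ ∑ _j : τ, m * M := by
              refine Finset.sum_le_sum fun j _ => (totalDegree_pow _ _).trans ?_
              rw [mul_comm]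
              exact Nat.mul_le_mul (hF j) (by have := (s j).2; omega)
          _ = r * m * M := by simp [hcard, r, mul_assoc]
      · refine (totalDegree_pow _ _).trans ?_
        rw [totalDegree_X]
        have := b.2
        omega
    have hli' : LinearIndependent K (coeffs ∘ fun p : (τ → Fin (M + 1)) × Fin M =>
        (monomial (Finsupp.equivFunOnFinite.symm fun j => (p.1 j : ℕ)) 1 : P) •
          (X i : A) ^ (p.2 : ℕ)) := by
      refine hli.map_injOn _ ?_
      have hsub : ∀ q ∈ Submodule.span K (Set.range fun p : (τ → Fin (M + 1)) × Fin M =>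
          (monomial (Finsupp.equivFunOnFinite.symm fun j => (p.1 j : ℕ)) 1 : P) •
            (X i : A) ^ (p.2 : ℕ)), q.totalDegree ≤ D := by
        intro q hq
        have : Submodule.span K (Set.range fun p : (τ → Fin (M + 1)) × Fin M =>
          (monomial (Finsupp.equivFunOnFinite.symm fun j => (p.1 j : ℕ)) 1 : P) •
            (X i : A) ^ (p.2 : ℕ)) ≤ restrictTotalDegree σ K D := by
          rw [Submodule.span_le]
          rintro _ ⟨p, rfl⟩
          exact (mem_restrictTotalDegree _ _ _).mpr (hdeg p.1 p.2)
        exact (mem_restrictTotalDegree _ _ _).mp (this hq)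
      refine LinearMap.injOn_of_disjoint_ker le_rfl ?_
      rw [Submodule.disjoint_def]
      intro q hq hq0
      ext s
      by_contra hs
      have hsupp : s ∈ q.support := mem_support_iff.mpr (by simpa using hs)
      have hle : ∀ j, s j < D + 1 := fun j => by
        have h1 := le_totalDegree hsupp
        rw [Finsupp.sum_fintype _ _ (fun _ => rfl)] at h1
        have h2 : s j ≤ ∑ j, s j := Finset.single_le_sum (fun _ _ => Nat.zero_le _)
          (Finset.mem_univ j)
        have h3 := hsub q hq
        omega
      have := congrFun (LinearMap.mem_ker.mp hq0) fun j => ⟨s j, hle j⟩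
      apply hs
      have e : (Finsupp.equivFunOnFinite.symm fun j => s j) = s := by ext; simp
      simpa [coeffs, lcoeff, e] using this
    have hc := hli'.fintype_card_le_finrank
    simp only [Fintype.card_prod, Fintype.card_fun, Fintype.card_fin, hcard,
      Module.finrank_fintype_fun_eq_card] at hc
    have h1 : (D + 1) ^ r ≤ (r * m + 1) ^ r * (M + 1) ^ r := by
      rw [← mul_pow]
      refine Nat.pow_le_pow_left ?_ _
      rw [hD]
      nlinarith
    have h2 : (M + 1) ^ r * ((r * m + 1) ^ r) < (M + 1) ^ r * M :=
      Nat.mul_lt_mul_of_pos_left hlt (by positivity)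
    rw [mul_comm] at h1
    exact absurd (hc.trans h1) (not_le.mpr h2)
  · intro z hz
    -- At a common zero z of the F_j, evaluation restricted to `P` kills every variable, so it is
    -- the constant coefficient map. The minimal polynomial of X_i thereby specializes to a fixed
    -- monic polynomial vanishing at z_i.
    have h0 : Polynomial.eval₂ (algebraMap P A) (X i) f = 0 := minpoly.aeval P (X i : A)
    have h1 := congrArg (aeval z : A →ₐ[K] K).toRingHom h0
    rw [Polynomial.hom_eval₂, map_zero] at h1
    have h2 : (aeval z : A →ₐ[K] K).toRingHom.comp (algebraMap P A) = constantCoeff := by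
      refine MvPolynomial.ringHom_ext (fun c => ?_) (fun j => ?_)
      · change aeval z (aeval F (C c)) = _
        simp
      · change aeval z (aeval F (X j)) = _
        simp [hz]
    rw [h2] at h1
    rw [Polynomial.eval_map]
    simpa using h1

/-- A system of `r` polynomials of degree `m` in `r` variables over an algebraically closed field,
whose leading forms have no nontrivial common zero, has a bounded number of zeros in any subset. -/
theorem card_zeros_le {G F : τ → MvPolynomial σ K} {m : ℕ} (hm : 0 < m)
    (hcard : Fintype.card τ = Fintype.card σ)
    (hG : ∀ j, (G j).IsHomogeneous m) (hF : ∀ j, (F j - G j).totalDegree < m)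
    (h : ∀ i, X i ∈ (Ideal.span (Set.range G)).radical) :
    {z : σ → K | ∀ j, aeval z (F j) = 0}.Finite ∧ {z : σ → K | ∀ j, aeval z (F j) = 0}.ncard ≤
      ((Fintype.card σ * m + 1) ^ Fintype.card σ) ^ Fintype.card σ := by
  classical
  have hint := isIntegral_aeval_of_leadingForms hm hG hF h
  have hinj := aeval_injective_of_isIntegral hcard hint
  have hdeg : ∀ j, (F j).totalDegree ≤ m := fun j => by
    have := totalDegree_add (F j - G j) (G j)
    rw [sub_add_cancel] at this
    exact this.trans (max_le (hF j).le (hG j).totalDegree_le)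
  choose Q hQ0 hQd hQ using exists_polynomial_of_isIntegral hdeg hinj hint hcard
  have hsub : {z : σ → K | ∀ j, aeval z (F j) = 0} ⊆
      (Fintype.piFinset fun i => (Q i).roots.toFinset : Finset (σ → K)) := by
    intro z hz
    simp only [Fintype.coe_piFinset, Set.mem_pi, Finset.mem_coe, Multiset.mem_toFinset]
    intro i _
    exact (Polynomial.mem_roots (hQ0 i)).mpr (hQ i z hz)
  refine ⟨(Finset.finite_toSet _).subset hsub, ?_⟩
  refine (Set.ncard_le_ncard hsub (Finset.finite_toSet _)).trans ?_
  rw [Set.ncard_coe_finset, Fintype.card_piFinset]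
  calc ∏ i, (Q i).roots.toFinset.card
      ≤ ∏ _i : σ, (Fintype.card σ * m + 1) ^ Fintype.card σ :=
        Finset.prod_le_prod' fun i _ => (Multiset.toFinset_card_le _).trans
          ((Polynomial.card_roots' _).trans (hQd i))
    _ = _ := by simp

end MvPolynomial

/-! ### Counting zeros of the multilinear system attached to a smooth hypersurface -/

theorem Derivation.map_prod_univ_succ {R A : Type*} [CommRing R] [CommRing A] [Algebra R A]
    (D : Derivation R A A) {m : ℕ} (f : Fin (m + 1) → A) :
    D (∏ i, f i) = ∑ i, (∏ l, f (i.succAbove l)) * D (f i) := by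
  induction m with
  | zero => simp
  | succ m ih =>
    rw [Fin.prod_univ_succ, Derivation.leibniz, ih fun i => f i.succ, Fin.sum_univ_succ (n := m + 1)]
    simp only [smul_eq_mul, Fin.succAbove_zero]
    rw [add_comm, Finset.mul_sum]
    congr 1
    refine Finset.sum_congr rfl fun i _ => ?_
    rw [Fin.prod_univ_succ (fun l => f (i.succ.succAbove l))]
    simp only [Fin.succ_succAbove_zero, Fin.succ_succAbove_succ]
    ring

/-- A symmetric family takes the same value wherever an entry is inserted. -/
theorem apply_insertNth_of_symmetric {k ι : Type*} {m : ℕ}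
    {a : (Fin (m + 1) → ι) → k}
    (ha : ∀ (σ : Equiv.Perm (Fin (m + 1))) (J : Fin (m + 1) → ι), a (J ∘ σ) = a J)
    (i i' : Fin (m + 1)) (j : ι) (J : Fin m → ι) :
    a (i.insertNth j J : Fin (m + 1) → ι) = a (i'.insertNth j J : Fin (m + 1) → ι) := by
  rw [← ha ((finSuccEquiv' i').trans (finSuccEquiv' i).symm)]
  congr 1
  ext l
  cases l using Fin.succAboveCases i' with
  | x => simp
  | p l => simp

section Multilinear

variable {k : Type u} [Field k] {n m : ℕ}

/-- The coefficients of the last partial multilinear forms. -/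
def lastCoeff (a : (Fin (m + 1) → Fin (n + 1)) → k) (j : Fin (n + 1)) (J : Fin m → Fin (n + 1)) :
    k :=
  a (Fin.snoc J j : Fin (m + 1) → Fin (n + 1))

/-- The form of degree `m` obtained by restricting a multilinear form to the diagonal. -/
def diagForm (a : (Fin (m + 1) → Fin (n + 1)) → k) (j : Fin (n + 1)) :
    MvPolynomial (Fin (n + 1)) k :=
  ∑ J : Fin m → Fin (n + 1), MvPolynomial.C (lastCoeff a j J) * ∏ i, MvPolynomial.X (J i)

/-- By the Leibniz rule each of the m + 1 slots of the symmetric tensor contributes once, and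
symmetry makes all contributions equal. -/
theorem pderiv_eq_smul_diagForm {f : MvPolynomial (Fin (n + 1)) k}
    {a : (Fin (m + 1) → Fin (n + 1)) → k} (ha : IsSymmetricCoefficients f a) (j : Fin (n + 1)) :
    MvPolynomial.pderiv j f = (m + 1) • diagForm a j := by
  rw [ha.2, map_sum]
  simp only [MvPolynomial.pderiv_C_mul, Derivation.map_prod_univ_succ, MvPolynomial.pderiv_X,
    Finset.mul_sum]
  rw [Finset.sum_comm]
  have h : ∀ i : Fin (m + 1), ∑ J : Fin (m + 1) → Fin (n + 1),
      MvPolynomial.C (a J) * ((∏ l, MvPolynomial.X (J (i.succAbove l))) *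
        (Pi.single j 1 : Fin (n + 1) → MvPolynomial (Fin (n + 1)) k) (J i)) = diagForm a j := by
    intro i
    rw [← (Fin.insertNthEquiv (fun _ => Fin (n + 1)) i).sum_comp, Fintype.sum_prod_type]
    rw [Finset.sum_eq_single j]
    · refine Finset.sum_congr rfl fun J _ => ?_
      simp only [Fin.insertNthEquiv_apply, Fin.insertNth_apply_same, Fin.insertNth_apply_succAbove,
        Pi.single_eq_same, mul_one, lastCoeff]
      have h1 := apply_insertNth_of_symmetric ha.1 i (Fin.last m) j J
      rw [Fin.insertNth_last'] at h1
      rw [← h1]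
      rfl
    · intro b _ hb
      refine Finset.sum_eq_zero fun J _ => ?_
      simp [Pi.single_eq_of_ne hb]
    · simp
  rw [Finset.sum_congr rfl fun i _ => h i]
  simp

theorem diagForm_isHomogeneous (a : (Fin (m + 1) → Fin (n + 1)) → k) (j : Fin (n + 1)) :
    (diagForm a j).IsHomogeneous m := by
  refine MvPolynomial.IsHomogeneous.sum _ _ _ fun J _ => ?_
  have := MvPolynomial.IsHomogeneous.prod (Finset.univ : Finset (Fin m))
    (fun i => (MvPolynomial.X (J i) : MvPolynomial (Fin (n + 1)) k)) (fun _ => 1)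
    fun i _ => MvPolynomial.isHomogeneous_X _ _
  simpa using (MvPolynomial.isHomogeneous_C (Fin (n + 1)) (lastCoeff a j J)).mul this

/-- For a smooth hypersurface of degree prime to the characteristic, the partial derivatives
generate an ideal containing powers of all variables. -/
theorem X_mem_radical_span_diagForm {f : MvPolynomial (Fin (n + 1)) k}
    {a : (Fin (m + 1) → Fin (n + 1)) → k} (ha : IsSymmetricCoefficients f a)
    (hf : IsSmoothHypersurface f (m + 1)) (hm : ((m + 1 : ℕ) : k) ≠ 0) (i : Fin (n + 1)) :
    MvPolynomial.X i ∈ (Ideal.span (Set.range (diagForm a))).radical := by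
  have hrad := MvPolynomial.vanishingIdeal_zeroLocus_eq_radical (K := AlgebraicClosure k)
    (Ideal.span (Set.range (diagForm a)))
  rw [← hrad]
  intro x hx
  rw [MvPolynomial.zeroLocus_span] at hx
  have h1 : ∀ j, MvPolynomial.aeval x (MvPolynomial.pderiv j f) = 0 := fun j => by
    rw [pderiv_eq_smul_diagForm ha, map_nsmul, hx _ ⟨j, rfl⟩, smul_zero]
  -- Euler's identity: the degree is nonzero in k, so f vanishes wherever all its partial
  -- derivatives do.
  have h2 : MvPolynomial.aeval x f = 0 := by
    have := congrArg (MvPolynomial.aeval x) hf.1.sum_X_mul_pderiv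
    rw [map_sum, map_nsmul, Finset.sum_eq_zero fun j _ => by rw [map_mul, h1, mul_zero],
      nsmul_eq_mul] at this
    refine (mul_eq_zero.mp this.symm).resolve_left fun h => hm ?_
    apply (algebraMap k (AlgebraicClosure k)).injective
    rw [map_natCast, h, map_zero]
  rw [hf.2 x h2 h1]
  simp

/-- Translating the variables changes only lower-order terms, so every slice of the multilinear
system keeps the leading forms `diagForm`. For m = 0 the difference is zero, which makes the
truncated `m - 1` harmless. -/
theorem MvPolynomial.totalDegree_prod_add_C_sub_prod_X_le {K σ : Type*} [Field K]
    (J : Fin m → σ) (c : Fin m → K) :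
    (∏ i, (X (J i) + C (c i)) - ∏ i, X (J i) : MvPolynomial σ K).totalDegree ≤ m - 1 := by
  induction m with
  | zero => simp
  | succ m ih =>
    rw [Fin.prod_univ_succ, Fin.prod_univ_succ]
    have e : ((X (J 0) + C (c 0)) * ∏ i : Fin m, (X (J i.succ) + C (c i.succ)) -
        X (J 0) * ∏ i : Fin m, X (J i.succ) : MvPolynomial σ K) =
        X (J 0) * (∏ i : Fin m, (X (J i.succ) + C (c i.succ)) - ∏ i : Fin m, X (J i.succ)) +
          C (c 0) * ∏ i : Fin m, (X (J i.succ) + C (c i.succ)) := by ring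
    rw [e]
    refine (totalDegree_add _ _).trans (max_le ?_ ?_)
    · rcases Nat.eq_zero_or_pos m with rfl | hm
      · simp
      · refine (totalDegree_mul _ _).trans ?_
        have := ih (fun i => J i.succ) fun i => c i.succ
        rw [totalDegree_X]
        omega
    · refine (totalDegree_mul _ _).trans ?_
      rw [totalDegree_C, zero_add]
      refine (totalDegree_finsetProd _ _).trans ?_
      refine (Finset.sum_le_sum (g := fun _ => 1) fun i _ => ?_).trans (by simp)
      refine (totalDegree_add _ _).trans (max_le ?_ ?_)
      · rw [totalDegree_X]
      · rw [totalDegree_C]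
        exact Nat.zero_le _

/-- Each translate of the diagonal contains a bounded number of zeros of the multilinear system. -/
theorem card_diagonal_translate_le {K : Type*} [Field K] [Algebra k K] (hm : 0 < m)
    {a : (Fin (m + 1) → Fin (n + 1)) → k}
    (ha : ∀ i, MvPolynomial.X i ∈ (Ideal.span (Set.range (diagForm a))).radical)
    (v : Fin m → Fin (n + 1) → K) :
    {z : Fin (n + 1) → K | ∀ j, ∑ J : Fin m → Fin (n + 1),
      algebraMap k K (lastCoeff a j J) * ∏ i, (z (J i) + v i (J i)) = 0}.Finite ∧
    {z : Fin (n + 1) → K | ∀ j, ∑ J : Fin m → Fin (n + 1),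
      algebraMap k K (lastCoeff a j J) * ∏ i, (z (J i) + v i (J i)) = 0}.ncard ≤
      (((n + 1) * m + 1) ^ (n + 1)) ^ (n + 1) := by
  let F : Fin (n + 1) → MvPolynomial (Fin (n + 1)) K := fun j => ∑ J : Fin m → Fin (n + 1),
    MvPolynomial.C (algebraMap k K (lastCoeff a j J)) *
      ∏ i, (MvPolynomial.X (J i) + MvPolynomial.C (v i (J i)))
  let G : Fin (n + 1) → MvPolynomial (Fin (n + 1)) K := fun j =>
    MvPolynomial.map (algebraMap k K) (diagForm a j)
  have hGe : ∀ j, G j = ∑ J : Fin m → Fin (n + 1),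
      MvPolynomial.C (algebraMap k K (lastCoeff a j J)) * ∏ i, MvPolynomial.X (J i) := by
    intro j
    simp [G, diagForm]
  have key := MvPolynomial.card_zeros_le (G := G) (F := F) hm rfl
    (fun j => (diagForm_isHomogeneous a j).map _) (fun j => by
      rw [hGe, ← Finset.sum_sub_distrib]
      refine lt_of_le_of_lt (MvPolynomial.totalDegree_finsetSum_le (d := m - 1) fun J _ => ?_)
        (by omega)
      rw [← mul_sub]
      refine (MvPolynomial.totalDegree_mul _ _).trans ?_
      rw [MvPolynomial.totalDegree_C, zero_add]
      exact MvPolynomial.totalDegree_prod_add_C_sub_prod_X_le _ _) (fun i => by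
      obtain ⟨N, hN⟩ := ha i
      refine ⟨N, ?_⟩
      have := Ideal.mem_map_of_mem (MvPolynomial.map (algebraMap k K)) hN
      rw [Ideal.map_span, ← Set.range_comp, map_pow, MvPolynomial.map_X] at this
      exact this)
  have e : {z : Fin (n + 1) → K | ∀ j, MvPolynomial.aeval z (F j) = 0} =
      {z : Fin (n + 1) → K | ∀ j, ∑ J : Fin m → Fin (n + 1),
        algebraMap k K (lastCoeff a j J) * ∏ i, (z (J i) + v i (J i)) = 0} := by
    ext z
    simp [F]
  rw [e] at key
  simpa using key

/-- The number of zeros of the multilinear system with coordinates in a finite subgroup. -/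
theorem card_multilinear_zeros_le {K : Type*} [Field K] [Algebra k K]
    {a : (Fin (m + 1 + 1) → Fin (n + 1)) → k}
    (ha : ∀ i, MvPolynomial.X i ∈ (Ideal.span (Set.range (diagForm a))).radical)
    (V : Submodule k K) [Finite V] :
    Nat.card {x : Fin (m + 1) → Fin (n + 1) → V // ∀ j, ∑ J : Fin (m + 1) → Fin (n + 1),
      algebraMap k K (lastCoeff a j J) * ∏ i, (x i (J i) : K) = 0} ≤
    (((n + 1) * (m + 1) + 1) ^ (n + 1)) ^ (n + 1) * Nat.card V ^ (m * (n + 1)) := by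
  classical
  have := Fintype.ofFinite V
  rw [Nat.card_eq_fintype_card, Fintype.card_subtype]
  -- The fibre of this difference map over `w` is a translate of the diagonal, parametrized by the
  -- vector `x 0`.
  let φ : (Fin (m + 1) → Fin (n + 1) → V) → (Fin m → Fin (n + 1) → V) :=
    fun x i l => x i.succ l - x 0 l
  refine (Finset.card_le_mul_card_image_of_maps_to (f := φ) (t := Finset.univ)
    (fun _ _ => Finset.mem_univ _) ((((n + 1) * (m + 1) + 1) ^ (n + 1)) ^ (n + 1)) ?_).trans ?_
  · intro w _
    let v : Fin (m + 1) → Fin (n + 1) → K := Fin.cons 0 fun i l => (w i l : K)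
    obtain ⟨hfin, hcard⟩ := card_diagonal_translate_le (Nat.succ_pos m) ha v
    refine le_trans ?_ hcard
    rw [← Set.ncard_coe_finset]
    have hx : ∀ x : Fin (m + 1) → Fin (n + 1) → V, φ x = w →
        ∀ i l, (x i l : K) = x 0 l + v i l := by
      intro x hx i l
      cases i using Fin.cases with
      | zero => simp [v]
      | succ i => simp [v, ← hx, φ]
    refine Set.ncard_le_ncard_of_injOn (fun x l => (x 0 l : K)) ?_ ?_ hfin
    · intro x hx'
      simp only [Finset.coe_filter, Finset.mem_filter, Finset.mem_univ, true_and,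
        Set.mem_ofPred_eq] at hx'
      intro j
      rw [← hx'.1 j]
      refine Finset.sum_congr rfl fun J _ => ?_
      congr 1
      exact Finset.prod_congr rfl fun i _ => (hx x hx'.2 i (J i)).symm
    · intro x hx1 y hy1 hxy
      simp only [Finset.coe_filter, Finset.mem_filter, Finset.mem_univ, true_and,
        Set.mem_ofPred_eq] at hx1 hy1
      ext i l
      rw [hx x hx1.2, hx y hy1.2]
      exact congrArg (· + v i l) (congrFun hxy l)
  · refine Nat.mul_le_mul_left _ ?_
    rw [Finset.card_univ, Fintype.card_fun, Fintype.card_fun, Nat.card_eq_fintype_card, ← pow_mul]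
    simp [mul_comm]

end Multilinear

/-! ### Local rings and residue fields of a smooth projective curve -/

/-- A field that is standard smooth of relative dimension one over a finite field cannot be of
finite type over it. -/
theorem not_isField_of_isStandardSmooth (B A : Type*) [Field B] [PerfectField B] [CommRing A]
    [Algebra B A] [Algebra.IsStandardSmoothOfRelativeDimension 1 B A] : ¬ IsField A := by
  intro h
  let := h.toField
  have : Algebra.IsStandardSmooth B A :=
    Algebra.IsStandardSmoothOfRelativeDimension.isStandardSmooth 1
  have : Algebra.FiniteType B A := inferInstance
  -- By Zariski's lemma the field is finite over the perfect field B, hence separable. Its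
  -- differentials vanish, contradicting rank one.
  have : Module.Finite B A := finite_of_finite_type_of_isJacobsonRing B A
  have : Algebra.IsSeparable B A := inferInstance
  have : Algebra.FormallyUnramified B A := Algebra.FormallyUnramified.of_isSeparable B A
  have h1 := Algebra.IsStandardSmoothOfRelativeDimension.rank_kaehlerDifferential
      (R := B) (S := A) 1
  rw [rank_subsingleton'] at h1
  simp at h1

namespace SmoothProjectiveCurve

variable {k : Type u} [Field k] (C : SmoothProjectiveCurve k)

/-- The ring of sections over an open subset as an algebra over the ground field. -/
instance sectionsAlgebra (U : C.X.Opens) : Algebra k Γ(C.X, U) :=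
  ((Scheme.ΓSpecIso (.of k)).inv ≫ C.π.appLE ⊤ U le_top).hom.toAlgebra

/-- The local ring at a closed point as an algebra over the ground field. -/
instance stalkAlgebra (x : C.ClosedPoint) : Algebra k (C.X.presheaf.stalk x.1) :=
  ((C.X.presheaf.germ ⊤ x.1 trivial).hom.comp
    ((Scheme.ΓSpecIso (.of k)).inv ≫ C.π.appTop).hom).toAlgebra

theorem germ_algebraMap (U : C.X.Opens) (x : C.ClosedPoint) (hx : x.1 ∈ U) (c : k) :
    C.X.presheaf.germ U x.1 hx (algebraMap k Γ(C.X, U) c) =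
      algebraMap k (C.X.presheaf.stalk x.1) c := by
  exact C.X.presheaf.germ_res_apply (homOfLE (le_top : U ≤ ⊤)) x.1 hx
    (C.π.appTop ((Scheme.ΓSpecIso (.of k)).inv c))

theorem germToFunctionField_algebraMap (U : C.X.Opens) [Nonempty U] (c : k) :
    C.X.germToFunctionField U (algebraMap k Γ(C.X, U) c) = algebraMap k C.K c := by
  exact C.X.presheaf.germ_res_apply (homOfLE (le_top : U ≤ ⊤)) _
    (((genericPoint_spec C.X).mem_open_set_iff U.isOpen).mpr (by simpa using ‹Nonempty U›))
    (C.π.appTop ((Scheme.ΓSpecIso (.of k)).inv c))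

instance (U : C.X.Opens) [Nonempty U] : IsScalarTower k Γ(C.X, U) C.K :=
  IsScalarTower.of_algebraMap_eq fun c => (C.germToFunctionField_algebraMap U c).symm

instance (x : C.ClosedPoint) : IsScalarTower k (C.X.presheaf.stalk x.1) C.K :=
  IsScalarTower.of_algebraMap_eq fun c =>
    (Scheme.algebraMap_germ_eq_germToFunctionField (X := C.X) (U := ⊤) (x := x.1) trivial
      (C.π.appTop ((Scheme.ΓSpecIso (.of k)).inv c))).symm

theorem finiteType_sections {V : C.X.Opens} (hV : IsAffineOpen V) :
    Algebra.FiniteType k Γ(C.X, V) := by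
  have h := C.π.finiteType_appLE (isAffineOpen_top _) hV le_top
  rw [← RingHom.finiteType_algebraMap (A := k)]
  change ((C.π.appLE ⊤ V le_top).hom.comp (Scheme.ΓSpecIso (.of k)).inv.hom).FiniteType
  exact h.comp (RingHom.FiniteType.of_surjective _
    (Scheme.ΓSpecIso (.of k)).symm.commRingCatIsoToRingEquiv.surjective)

theorem exists_affine_mem (x : C.X) : ∃ V : C.X.Opens, IsAffineOpen V ∧ x ∈ V := by
  obtain ⟨_, ⟨U, hU, rfl⟩, hxU, -⟩ :=
    C.X.isBasis_affineOpens.exists_subset_of_mem_open (Set.mem_univ x) isOpen_univ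
  exact ⟨U, hU, hxU⟩

/-- A closed point gives a maximal ideal of Γ(V), whose quotient is already the residue field.
Zariski's lemma then makes residue fields finite over k. -/
theorem residue_germ_surjective {V : C.X.Opens} (hV : IsAffineOpen V) (x : C.ClosedPoint)
    (hx : x.1 ∈ V) : Function.Surjective
      ((residue (C.X.presheaf.stalk x.1)).comp (C.X.presheaf.germ V x.1 hx).hom) := by
  let := TopCat.Presheaf.algebra_section_stalk C.X.presheaf ⟨x.1, hx⟩
  have := hV.isLocalization_stalk ⟨x.1, hx⟩
  have hmax := hV.primeIdealOf_isMaximal_of_isClosed ⟨x.1, hx⟩ x.2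
  intro y
  obtain ⟨z, hz⟩ := (IsLocalization.AtPrime.equivQuotMaximalIdeal
    (hV.primeIdealOf ⟨x.1, hx⟩).asIdeal (C.X.presheaf.stalk x.1)).surjective y
  obtain ⟨w, rfl⟩ := Ideal.Quotient.mk_surjective z
  refine ⟨w, ?_⟩
  rw [← hz, IsLocalization.AtPrime.equivQuotMaximalIdeal_apply_mk]
  rfl

instance finite_residueField (x : C.ClosedPoint) :
    Module.Finite k (ResidueField (C.X.presheaf.stalk x.1)) := by
  obtain ⟨V, hV, hx⟩ := C.exists_affine_mem x.1
  have := C.finiteType_sections hV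
  let φ : Γ(C.X, V) →ₐ[k] ResidueField (C.X.presheaf.stalk x.1) :=
    { (residue (C.X.presheaf.stalk x.1)).comp (C.X.presheaf.germ V x.1 hx).hom with
      commutes' := fun c => by
        change residue _ (C.X.presheaf.germ V x.1 hx (algebraMap k Γ(C.X, V) c)) = _
        rw [germ_algebraMap]
        rfl }
  have : Algebra.FiniteType k (ResidueField (C.X.presheaf.stalk x.1)) :=
    Algebra.FiniteType.of_surjective φ (C.residue_germ_surjective hV x hx)
  exact finite_of_finite_type_of_isJacobsonRing _ _

/-- The residue degree is taken over the residue field of the image point in Spec k; the work lies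
in identifying that field with k. -/
theorem pointDegree_eq_finrank (x : C.ClosedPoint) :
    C.pointDegree x = Module.finrank k (ResidueField (C.X.presheaf.stalk x.1)) := by
  let e₀ : CommRingCat.of k ⟶ (Spec (.of k)).residueField (C.π x.1) :=
    (Scheme.ΓSpecIso (.of k)).inv ≫ (Spec (.of k)).Γevaluation (C.π x.1)
  have hinj : Function.Injective e₀.hom := e₀.hom.injective
  have hsurj : Function.Surjective e₀.hom := by
    intro y
    have hmax : PrimeSpectrum.asIdeal (R := k) (C.π x.1) |>.IsMaximal :=
      have := PrimeSpectrum.isPrime (R := k) (C.π x.1)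
      IsArtinianRing.isMaximal_of_isPrime _
    obtain ⟨c, hc⟩ := Ideal.algebraMap_residueField_surjective
      (PrimeSpectrum.asIdeal (R := k) (C.π x.1))
      ((Scheme.Spec.residueFieldIso (.of k) (C.π x.1)).hom y)
    refine ⟨c, ?_⟩
    have h1 := ConcreteCategory.congr_hom
      (Scheme.Spec.algebraMap_residueFieldIso_inv (.of k) (C.π x.1)) c
    refine h1.symm.trans ?_
    refine (congrArg (Scheme.Spec.residueFieldIso (.of k) (C.π x.1)).inv hc).trans ?_
    exact ConcreteCategory.congr_hom
      (Scheme.Spec.residueFieldIso (.of k) (C.π x.1)).hom_inv_id y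
  let e : k ≃+* (Spec (.of k)).residueField (C.π x.1) := RingEquiv.ofBijective e₀.hom ⟨hinj, hsurj⟩
  rw [pointDegree, Scheme.Hom.residueDegree]
  exact (@Algebra.finrank_eq_of_equiv_equiv _ _ _ _ _ _ _ _ _
    (C.π.residueFieldMap x.1).hom.toAlgebra e
    (RingEquiv.refl (ResidueField (C.X.presheaf.stalk x.1))) (RingHom.ext fun c =>
      Scheme.Γevaluation_naturality_apply C.π x.1 ((Scheme.ΓSpecIso (.of k)).inv c))).symm

theorem ord_one {C : SmoothProjectiveCurve k} (x : C.ClosedPoint) : C.X.ord (1 : C.K) x.1 = 0 := by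
  rw [← map_one (algebraMap k C.K), ord_algebraMap]

theorem ord_inv {C : SmoothProjectiveCurve k} (x : C.ClosedPoint) (f : C.K) :
    C.X.ord f⁻¹ x.1 = -C.X.ord f x.1 := by
  by_cases hf : f = 0
  · simp [hf]
  have h := Scheme.ord_mul (x := x.1) hf (inv_ne_zero hf)
  rw [mul_inv_cancel₀ hf, ord_one] at h
  omega

theorem ord_pow {C : SmoothProjectiveCurve k} (x : C.ClosedPoint) (f : C.K) (n : ℕ) :
    C.X.ord (f ^ n) x.1 = n * C.X.ord f x.1 := by
  by_cases hf : f = 0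
  · subst hf
    rcases Nat.eq_zero_or_pos n with rfl | hn
    · simp [ord_one]
    · simp [zero_pow hn.ne']
  induction n with
  | zero => simp [ord_one]
  | succ n ih =>
    rw [pow_succ, Scheme.ord_mul (pow_ne_zero _ hf) hf, ih]
    push_cast
    ring

theorem ord_zpow {C : SmoothProjectiveCurve k} (x : C.ClosedPoint) (f : C.K) (n : ℤ) :
    C.X.ord (f ^ n) x.1 = n * C.X.ord f x.1 := by
  obtain ⟨m, rfl | rfl⟩ := n.eq_nat_or_neg
  · rw [zpow_natCast, ord_pow]
  · rw [zpow_neg, ord_inv, zpow_natCast, ord_pow]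
    ring

variable [Finite k]

/-- The stalk is a principal ideal domain, and it is not a field: a smooth affine neighbourhood of
relative dimension one has a coordinate ring that is not a field, so its maximal ideals are nonzero.
-/
theorem coheight_eq_one (x : C.ClosedPoint) : Order.coheight x.1 = 1 := by
  have hpid := isPrincipalIdealRing_stalk C.π x.1
  suffices h : ¬ IsField (C.X.presheaf.stalk x.1) by
    have : IsDiscreteValuationRing (C.X.presheaf.stalk x.1) :=
      { not_a_field' := fun h' => h (isField_iff_maximalIdeal_eq.mpr h') }
    have h1 := IsPrincipalIdealRing.ringKrullDim_eq_one (C.X.presheaf.stalk x.1) h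
    rw [ringKrullDim_stalk_eq_coheight] at h1
    exact_mod_cast h1
  obtain ⟨U, hU, V, hV, hx, e, hf⟩ :=
    SmoothOfRelativeDimension.exists_isStandardSmoothOfRelativeDimension (n := 1) (f := C.π) x.1
  have hUtop : U = ⊤ := by
    rw [eq_top_iff]
    rintro y -
    have : y = C.π x.1 := Subsingleton.elim _ _
    exact this ▸ e hx
  subst hUtop
  let eB : k ≃+* Γ(Spec (.of k), ⊤) :=
    (Scheme.ΓSpecIso (.of k)).symm.commRingCatIsoToRingEquiv
  let fB : Field Γ(Spec (.of k), ⊤) := (eB.symm.toMulEquiv.isField (Field.toIsField k)).toField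
  have : Finite Γ(Spec (.of k), ⊤) := Finite.of_equiv k eB.toEquiv
  algebraize [(C.π.appLE ⊤ V e).hom]
  have : Nonempty V := ⟨⟨x.1, hx⟩⟩
  let := TopCat.Presheaf.algebra_section_stalk C.X.presheaf ⟨x.1, hx⟩
  have := hV.isLocalization_stalk ⟨x.1, hx⟩
  have hmax := hV.primeIdealOf_isMaximal_of_isClosed ⟨x.1, hx⟩ x.2
  have hnf := not_isField_of_isStandardSmooth Γ(Spec (.of k), ⊤) Γ(C.X, V)
  refine IsLocalization.AtPrime.not_isField Γ(C.X, V) (P := (hV.primeIdealOf ⟨x.1, hx⟩).asIdeal)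
    (fun h0 => hnf ?_) _
  rw [h0] at hmax
  exact Ring.isField_iff_maximal_bot.mpr hmax

instance isDiscreteValuationRing_stalk (x : C.ClosedPoint) :
    IsDiscreteValuationRing (C.X.presheaf.stalk x.1) := by
  have := isPrincipalIdealRing_stalk C.π x.1
  refine { not_a_field' := fun h => ?_ }
  have hd := ringKrullDim_stalk_eq_coheight x.1
  rw [ringKrullDim_eq_zero_of_isField (isField_iff_maximalIdeal_eq.mpr h), coheight_eq_one] at hd
  simp at hd

variable {C}

theorem ord_eq_iff_ordFrac (x : C.ClosedPoint) {f : C.K} (hf : f ≠ 0) {n : ℤ} :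
    C.X.ord f x.1 = n ↔ Ring.ordFrac (C.X.presheaf.stalk x.1) f = WithZero.exp n :=
  Scheme.ord_eq_iff (C.coheight_eq_one x) hf

theorem le_ord_iff_ordFrac (x : C.ClosedPoint) {f : C.K} (hf : f ≠ 0) {n : ℤ} :
    n ≤ C.X.ord f x.1 ↔ WithZero.exp n ≤ Ring.ordFrac (C.X.presheaf.stalk x.1) f :=
  Scheme.le_ord_iff (C.coheight_eq_one x) hf

theorem ord_nonneg_of_stalk (x : C.ClosedPoint) (r : C.X.presheaf.stalk x.1) :
    0 ≤ C.X.ord (algebraMap _ C.K r) x.1 := by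
  by_cases hr : r = 0
  · simp [hr]
  rw [le_ord_iff_ordFrac x (by simpa using hr)]
  exact Ring.ordFrac_ge_one_of_ne_zero hr

theorem isUnit_iff_ord_eq_zero (x : C.ClosedPoint) {r : C.X.presheaf.stalk x.1} (hr : r ≠ 0) :
    IsUnit r ↔ C.X.ord (algebraMap _ C.K r) x.1 = 0 := by
  rw [ord_eq_iff_ordFrac x (by simpa using hr)]
  exact Ring.isUnit_iff_ordFrac_one_of_isDiscreteValuationRing

theorem mem_range_stalk_iff (x : C.ClosedPoint) (f : C.K) :
    f ∈ (algebraMap (C.X.presheaf.stalk x.1) C.K).range ↔ f = 0 ∨ 0 ≤ C.X.ord f x.1 := by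
  constructor
  · rintro ⟨r, rfl⟩
    exact Or.inr (ord_nonneg_of_stalk x r)
  rintro (rfl | h)
  · exact zero_mem _
  by_cases hf : f = 0
  · exact hf ▸ zero_mem _
  rcases ValuationRing.isInteger_or_isInteger (C.X.presheaf.stalk x.1) f with ⟨r, hr⟩ | ⟨r, hr⟩
  · exact ⟨r, hr⟩
  · have hr0 : r ≠ 0 := by
      rintro rfl
      rw [map_zero] at hr
      exact inv_ne_zero hf hr.symm
    have h1 := ord_nonneg_of_stalk x r
    have h2 : C.X.ord (algebraMap _ C.K r) x.1 = 0 := by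
      rw [hr, ord_inv] at h1 ⊢
      omega
    obtain ⟨u, hu⟩ := (isUnit_iff_ord_eq_zero x hr0).mpr h2
    refine ⟨(u⁻¹ : (C.X.presheaf.stalk x.1)ˣ), ?_⟩
    rw [← hu] at hr
    rw [map_units_inv, hr, inv_inv]

theorem exists_uniformizer (x : C.ClosedPoint) : ∃ ϖ : C.K, ϖ ≠ 0 ∧ C.X.ord ϖ x.1 = 1 := by
  obtain ⟨ϖ, hϖ⟩ := IsDiscreteValuationRing.exists_irreducible (C.X.presheaf.stalk x.1)
  have h0 : algebraMap _ C.K ϖ ≠ 0 := by simpa using hϖ.ne_zero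
  exact ⟨algebraMap _ C.K ϖ, h0, (ord_eq_iff_ordFrac x h0).mpr (Ring.ordFrac_irreducible hϖ)⟩

theorem exists_ord_eq (x : C.ClosedPoint) (n : ℤ) : ∃ f : C.K, f ≠ 0 ∧ C.X.ord f x.1 = n := by
  obtain ⟨ϖ, h0, h1⟩ := exists_uniformizer x
  exact ⟨ϖ ^ n, zpow_ne_zero n h0, by rw [ord_zpow, h1, mul_one]⟩

theorem mem_localSections_iff {D : C.Divisor} {x : C.ClosedPoint} {f : C.K} :
    f ∈ localSections D x ↔ f = 0 ∨ -D x ≤ C.X.ord f x.1 :=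
  ⟨fun h => h.imp_right fun h => by linarith, fun h => h.imp_right fun h => by linarith⟩

theorem mul_mem_localSections {D E : C.Divisor} {x : C.ClosedPoint} {f g : C.K}
    (hf : f ∈ localSections D x) (hg : g ∈ localSections E x) :
    f * g ∈ localSections (D + E) x := by
  by_cases h : f * g = 0
  · exact Or.inl h
  obtain ⟨h1, h2⟩ := mul_ne_zero_iff.mp h
  have h3 := hf.resolve_left h1
  have h4 := hg.resolve_left h2
  refine Or.inr ?_
  rw [Scheme.ord_mul h1 h2, Finsupp.add_apply]
  linarith

theorem localSections_mono {D E : C.Divisor} {x : C.ClosedPoint} (h : D x ≤ E x) :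
    localSections D x ≤ localSections E x := fun _ hf => hf.imp_right fun hf => by linarith

theorem localSections_congr {D E : C.Divisor} {x : C.ClosedPoint} (h : D x = E x) :
    localSections D x = localSections E x :=
  le_antisymm (localSections_mono h.le) (localSections_mono h.ge)

/-- The leading coefficient map on the sections of a divisor near a closed point. -/
theorem exists_leadingCoeff (D : C.Divisor) (x : C.ClosedPoint) :
    ∃ ρ : localSections D x →ₗ[k] ResidueField (C.X.presheaf.stalk x.1),
      Function.Surjective ρ ∧ ∀ f, ρ f = 0 ↔ (f : C.K) ∈ localSections (D - Finsupp.single x 1) x := by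
  let R := C.X.presheaf.stalk x.1
  -- Multiplication by `g` identifies the stalk of 𝒪(D) with the local ring; the leading coefficient
  -- is the residue of the product.
  obtain ⟨g, hg0, hg⟩ := exists_ord_eq x (D x)
  let ι : R →ₗ[k] C.K := (IsScalarTower.toAlgHom k R C.K).toLinearMap
  have hι : Function.Injective ι := IsFractionRing.injective R C.K
  have hmem : ∀ f : localSections D x, g * f ∈ LinearMap.range ι := fun f => by
    refine (mem_range_stalk_iff x _).mpr ?_
    rcases f.2 with h | h
    · exact Or.inl (by rw [h, mul_zero])
    · by_cases h0 : (f : C.K) = 0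
      · exact Or.inl (by rw [h0, mul_zero])
      · refine Or.inr ?_
        rw [Scheme.ord_mul hg0 h0, hg]
        linarith
  let θ : localSections D x →ₗ[k] R := (LinearEquiv.ofInjective ι hι).symm.toLinearMap ∘ₗ
    LinearMap.codRestrict (LinearMap.range ι)
      (LinearMap.mulLeft k g ∘ₗ (localSections D x).subtype) hmem
  have hθ : ∀ f, algebraMap R C.K (θ f) = g * f := fun f =>
    congrArg Subtype.val ((LinearEquiv.ofInjective ι hι).apply_symm_apply ⟨g * f, hmem f⟩)
  let ρ₀ : R →ₗ[k] ResidueField R := (IsScalarTower.toAlgHom k R (ResidueField R)).toLinearMap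
  refine ⟨ρ₀ ∘ₗ θ, ?_, ?_⟩
  · intro y
    obtain ⟨r, rfl⟩ := residue_surjective y
    have hf : g⁻¹ * algebraMap R C.K r ∈ localSections D x := by
      rcases (mem_range_stalk_iff x _).mp ⟨r, rfl⟩ with h | h
      · exact Or.inl (by rw [h, mul_zero])
      · by_cases h0 : algebraMap R C.K r = 0
        · exact Or.inl (by rw [h0, mul_zero])
        · refine Or.inr ?_
          rw [Scheme.ord_mul (inv_ne_zero hg0) h0, ord_inv, hg]
          linarith
    refine ⟨⟨_, hf⟩, ?_⟩
    have : θ ⟨_, hf⟩ = r := by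
      apply IsFractionRing.injective R C.K
      rw [hθ]
      exact mul_inv_cancel_left₀ hg0 _
    rw [LinearMap.comp_apply, this]
    rfl
  · intro f
    have h1 : (ρ₀ ∘ₗ θ) f = 0 ↔ ¬ IsUnit (θ f) := by
      rw [← mem_nonunits_iff, ← mem_maximalIdeal, ← residue_eq_zero_iff]
      rfl
    rw [h1, mem_localSections_iff]
    by_cases h0 : (f : C.K) = 0
    · have : θ f = 0 := by
        apply IsFractionRing.injective R C.K
        rw [hθ, h0, mul_zero, map_zero]
      exact iff_of_true (by rw [this]; exact not_isUnit_zero) (Or.inl h0)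
    · have hθ0 : θ f ≠ 0 := fun h => by
        have := hθ f
        rw [h, map_zero] at this
        exact mul_ne_zero hg0 h0 this.symm
      rw [isUnit_iff_ord_eq_zero x hθ0]
      have h2 := ord_nonneg_of_stalk x (θ f)
      rw [hθ, Scheme.ord_mul hg0 h0, hg] at h2 ⊢
      simp only [h0, false_or, Finsupp.coe_sub, Pi.sub_apply, Finsupp.single_eq_same]
      omega

end SmoothProjectiveCurve

/-! ### Global geometry of a smooth projective curve -/

/-- Krull dimension at most one descends along injective integral homomorphisms. -/
theorem krullDimLE_one_of_isIntegral (R S : Type*) [CommRing R] [CommRing S] [IsDomain R]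
    [IsDomain S] [Algebra R S] [Algebra.IsIntegral R S] [FaithfulSMul R S]
    [Ring.KrullDimLE 1 S] : Ring.KrullDimLE 1 R := by
  refine .mk₁' fun p hp0 hp => ?_
  obtain ⟨P, -, hP, hPp⟩ := Ideal.exists_ideal_over_prime_of_isIntegral_of_isPrime p (⊥ : Ideal S) (by
    rw [← RingHom.ker_eq_comap_bot, (RingHom.injective_iff_ker_eq_bot _).mp
      (FaithfulSMul.algebraMap_injective R S)]
    exact bot_le)
  have hPm : P.IsMaximal := Ideal.IsPrime.isMaximal_of_ne_bot hP (fun h => hp0 (by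
    rw [← hPp, h, ← RingHom.ker_eq_comap_bot, (RingHom.injective_iff_ker_eq_bot _).mp
      (FaithfulSMul.algebraMap_injective R S)]))
  rw [← hPp]
  exact Ideal.isMaximal_comap_of_isIntegral_of_isMaximal P

namespace SmoothProjectiveCurve

variable {k : Type u} [Field k] {C : SmoothProjectiveCurve k}

instance : CompactSpace C.X := (quasiCompact_iff_compactSpace C.π).mp inferInstance

instance : IsNoetherian C.X where

instance : C.X.IsSeparated := by
  refine ⟨?_⟩
  rw [← Limits.terminal.comp_from C.π]
  infer_instance

/-- Distinct closed points of a curve have incomparable local rings. -/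
theorem eq_of_range_stalk_le {x y : C.ClosedPoint}
    (h : (algebraMap (C.X.presheaf.stalk x.1) C.K).range ≤
      (algebraMap (C.X.presheaf.stalk y.1) C.K).range) : x = y := by
  have hinj : Function.Injective (algebraMap (C.X.presheaf.stalk y.1) C.K) :=
    IsFractionRing.injective (C.X.presheaf.stalk y.1) C.K
  let e : C.X.presheaf.stalk y.1 ≃+* (algebraMap (C.X.presheaf.stalk y.1) C.K).range :=
    RingEquiv.ofBijective (algebraMap (C.X.presheaf.stalk y.1) C.K).rangeRestrict
      ⟨fun a b hab => hinj (congrArg Subtype.val hab), RingHom.rangeRestrict_surjective _⟩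
  let ψ : C.X.presheaf.stalk x.1 →+* C.X.presheaf.stalk y.1 := e.symm.toRingHom.comp
    ((algebraMap (C.X.presheaf.stalk x.1) C.K).codRestrict
      (algebraMap (C.X.presheaf.stalk y.1) C.K).range fun a => h ⟨a, rfl⟩)
  have hψ : (algebraMap (C.X.presheaf.stalk y.1) C.K).comp ψ =
      algebraMap (C.X.presheaf.stalk x.1) C.K := by
    ext a
    exact congrArg Subtype.val (e.apply_symm_apply
      ⟨algebraMap (C.X.presheaf.stalk x.1) C.K a, h ⟨a, rfl⟩⟩)
  let ι := Spec.map (CommRingCat.ofHom (algebraMap (C.X.presheaf.stalk y.1) C.K))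
  have hι : IsDominant ι := by
    refine ⟨(PrimeSpectrum.denseRange_comap_iff_ker_le_nilRadical _).mpr ?_⟩
    change RingHom.ker (algebraMap (C.X.presheaf.stalk y.1) C.K) ≤ _
    rw [(RingHom.injective_iff_ker_eq_bot _).mp hinj]
    exact bot_le
  have hgen : ∀ z : C.ClosedPoint,
      Spec.map (CommRingCat.ofHom (algebraMap (C.X.presheaf.stalk z.1) C.K)) ≫
        C.X.fromSpecStalk z.1 = C.X.fromSpecStalk (genericPoint C.X) := fun z =>
    Scheme.SpecMap_stalkSpecializes_fromSpecStalk ((genericPoint_spec C.X).specializes trivial)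
  -- Both morphisms agree on the generic point of Spec 𝒪_y, so they coincide since C is separated.
  -- Hence y specializes to x, and y is closed.
  have key : Spec.map (CommRingCat.ofHom ψ) ≫ C.X.fromSpecStalk x.1 = C.X.fromSpecStalk y.1 := by
    refine ext_of_isDominant ι ?_
    rw [hgen y, ← Category.assoc, ← Spec.map_comp, ← CommRingCat.ofHom_comp, hψ, hgen x]
  have hy : y.1 ∈ Set.range (C.X.fromSpecStalk x.1) := by
    refine ⟨Spec.map (CommRingCat.ofHom ψ) (closedPoint _), ?_⟩
    exact (congrArg (fun φ : Spec (C.X.presheaf.stalk y.1) ⟶ C.X => φ (closedPoint _)) key).trans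
      Scheme.fromSpecStalk_closedPoint
  rw [Scheme.range_fromSpecStalk] at hy
  have := hy.mem_closed y.2 rfl
  exact Subtype.ext this

/-- Every nonempty open set containing all closed points is the whole curve. -/
theorem eq_top_of_closedPoints_mem {U : C.X.Opens} (h : ∀ x : C.ClosedPoint, x.1 ∈ U) :
    U = ⊤ := by
  by_contra hU
  have hne : ((U : Set C.X)ᶜ).Nonempty := by
    rw [Set.nonempty_compl]
    exact fun h' => hU (TopologicalSpace.Opens.ext h')
  obtain ⟨x, hx, hxc⟩ := U.isOpen.isClosed_compl.exists_closed_singleton hne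
  exact hx (h ⟨x, hxc⟩)

/-- A rational function that is regular at all closed points is a global section. -/
theorem mem_range_germToFunctionField_top {f : C.K}
    (h : ∀ x : C.ClosedPoint, f ∈ (algebraMap (C.X.presheaf.stalk x.1) C.K).range) :
    ∃ s : Γ(C.X, ⊤), C.X.germToFunctionField ⊤ s = f := by
  have hloc : ∀ x : C.ClosedPoint, ∃ (U : C.X.Opens) (_ : x.1 ∈ U) (_ : Nonempty U) (s : Γ(C.X, U)),
      C.X.germToFunctionField U s = f := by
    intro x
    obtain ⟨r, hr⟩ := h x
    obtain ⟨U, hU, s, hs⟩ := C.X.presheaf.exists_germ_eq r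
    have : Nonempty U := ⟨⟨_, hU⟩⟩
    refine ⟨U, hU, this, s, ?_⟩
    rw [← Scheme.algebraMap_germ_eq_germToFunctionField C.X hU, hs, hr]
  choose U hxU hne s hs using hloc
  have hcover : (⊤ : C.X.Opens) ≤ iSup U := by
    rw [eq_top_of_closedPoints_mem (U := iSup U) fun x =>
      TopologicalSpace.Opens.mem_iSup.mpr ⟨x, hxU x⟩]
  obtain ⟨t, ht, -⟩ := C.X.sheaf.existsUnique_gluing' U ⊤ (fun x => homOfLE le_top) hcover s (by
    intro x y
    have hxy : Nonempty (U x ⊓ U y : C.X.Opens) := by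
      have := nonempty_preirreducible_inter (U x).isOpen (U y).isOpen
        (by simpa using hne x) (by simpa using hne y)
      exact this.to_subtype
    apply C.X.germToFunctionField_injective (U x ⊓ U y)
    refine (C.X.presheaf.germ_res_apply _ _ _ _).trans
      (Eq.trans ?_ (C.X.presheaf.germ_res_apply _ _ _ _).symm)
    exact (hs x).trans (hs y).symm)
  refine ⟨t, ?_⟩
  obtain ⟨x, -, hx⟩ := isClosed_univ.exists_closed_singleton (X := C.X) Set.univ_nonempty
  rw [← hs ⟨x, hx⟩, ← ht ⟨x, hx⟩]
  exact (C.X.presheaf.germ_res_apply _ _ _ _).symm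

variable [Finite k]

theorem mem_H0_iff {D : C.Divisor} {f : C.K} : f ∈ H0 D ↔ ∀ x, f ∈ localSections D x := by
  simp [H0, Submodule.mem_iInf]

/-- Functions regular at every closed point glue to global sections, which are finite over k by
properness. This starts the induction over divisors. -/
instance finite_H0_zero : Module.Finite k (H0 (0 : C.Divisor)) := by
  have hfin : Module.Finite k Γ(C.X, ⊤) := by
    have h := finite_appTop_of_universallyClosed k C.π
    rw [← RingHom.finite_algebraMap]
    change ((C.π.appLE ⊤ ⊤ le_top).hom.comp (Scheme.ΓSpecIso (.of k)).inv.hom).Finite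
    have e : C.π.appLE ⊤ ⊤ le_top = C.π.appTop := Scheme.Hom.appLE_eq_app C.π (U := ⊤)
    rw [e]
    exact h.comp (RingHom.Finite.of_surjective _
      (Scheme.ΓSpecIso (.of k)).symm.commRingCatIsoToRingEquiv.surjective)
  let φ : Γ(C.X, ⊤) →ₗ[k] C.K := (IsScalarTower.toAlgHom k Γ(C.X, ⊤) C.K).toLinearMap
  have hle : H0 (0 : C.Divisor) ≤ LinearMap.range φ := by
    intro f hf
    rw [mem_H0_iff] at hf
    obtain ⟨s, hs⟩ := mem_range_germToFunctionField_top fun x =>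
      (mem_range_stalk_iff x f).mpr (by simpa [mem_localSections_iff] using hf x)
    exact ⟨s, hs⟩
  exact Submodule.finiteDimensional_of_le hle

/-- A nonzero rational function has finitely many zeros and poles. -/
theorem finite_ord_ne_zero {f : C.K} (hf : f ≠ 0) :
    {x : C.ClosedPoint | C.X.ord f x.1 ≠ 0}.Finite := by
  obtain ⟨U, -, f', hU, rfl, hf'⟩ := exists_isUnit_germ_eq C.X f hf
  obtain ⟨S, hS, hcl, hirr, hsup⟩ :=
    TopologicalSpace.NoetherianSpace.exists_finite_set_isClosed_irreducible
      U.isOpen.isClosed_compl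
  have hinj : Function.Injective fun x : C.ClosedPoint => ({x.1} : Set C.X) :=
    fun x y hxy => Subtype.ext (Set.singleton_injective hxy)
  refine (hS.preimage hinj.injOn).subset fun x hx => ?_
  have hxU : x.1 ∈ (U : Set C.X)ᶜ := fun h => hx (Scheme.ord_of_isUnit hf' h)
  rw [hsup] at hxU
  obtain ⟨t, ht, hxt⟩ := hxU
  obtain ⟨w, hw⟩ := QuasiSober.sober (hirr t ht) (hcl t ht)
  have hwU : w ∉ U := by
    have : w ∈ ⋃₀ S := ⟨t, ht, hw.mem⟩
    rwa [← hsup] at this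
  have hwx : w ⤳ x.1 := hw.specializes hxt
  have hηU : genericPoint C.X ∈ U :=
    ((genericPoint_spec C.X).mem_open_set_iff U.isOpen).mpr (by simpa using hU)
  have hlt : w < genericPoint C.X := lt_of_le_not_ge
    ((genericPoint_spec C.X).specializes trivial) fun h => hwU (h.mem_open U.isOpen hηU)
  -- A strict chain from x through w to the generic point would contradict coheight one. So x is
  -- itself the generic point of a component of the complement of U, and there are finitely many
  -- components.
  have hwx' : w = x.1 := by
    by_contra hne
    have hlt' : x.1 < w := lt_of_le_not_ge hwx fun h => hne (h.mem_closed x.2 rfl)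
    have h1 := Order.coheight_add_one_le hlt
    have h2 := Order.coheight_add_one_le hlt'
    rw [C.coheight_eq_one x] at h2
    have h3 : Order.coheight w = 0 := by
      have : Order.coheight w + 1 ≤ 0 + 1 := by simpa using h2
      exact le_antisymm ((ENat.add_le_add_iff_right ENat.one_ne_top).mp this) zero_le
    rw [h3] at h1
    simp at h1
  have : t = {x.1} := by
    rw [← hw.def, hwx', x.2.closure_eq]
  rw [Set.mem_preimage, ← this]
  exact ht

/-- The localization at each prime is a stalk of C, hence a principal ideal domain, so every height
is at most one. -/
theorem ringKrullDim_sections_le {V : C.X.Opens} (hV : IsAffineOpen V) :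
    Ring.KrullDimLE 1 Γ(C.X, V) := by
  rw [Ring.krullDimLE_iff, ringKrullDim_le_iff_height_le]
  intro p hp
  let y : PrimeSpectrum Γ(C.X, V) := ⟨p, hp⟩
  have hy : hV.fromSpec y ∈ V := by
    have : hV.fromSpec y ∈ Set.range hV.fromSpec := ⟨y, rfl⟩
    rwa [hV.range_fromSpec] at this
  let := TopCat.Presheaf.algebra_section_stalk C.X.presheaf (⟨hV.fromSpec y, hy⟩ : V)
  have hloc : IsLocalization.AtPrime (C.X.presheaf.stalk (hV.fromSpec y)) p :=
    hV.isLocalization_stalk' y hy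
  have hpid := isPrincipalIdealRing_stalk C.π (hV.fromSpec y)
  have h1 : Ring.KrullDimLE 1 (C.X.presheaf.stalk (hV.fromSpec y)) := inferInstance
  rw [Ring.krullDimLE_iff, IsLocalization.AtPrime.ringKrullDim_eq_height p] at h1
  exact h1

/-- Since k is finite, so is k[f]. Two distinct powers of f therefore coincide, and comparing their
orders forces order zero. -/
theorem ord_eq_zero_of_isIntegral (x : C.ClosedPoint) {f : C.K} (hf : IsIntegral k f) :
    C.X.ord f x.1 = 0 := by
  by_cases h0 : f = 0
  · simp [h0]
  have hfin : Module.Finite k (Algebra.adjoin k {f}) :=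
    ⟨(Submodule.fg_top _).mpr hf.fg_adjoin_singleton⟩
  have : Finite (Algebra.adjoin k {f}) := Module.finite_of_finite k
  obtain ⟨m, n, hmn, h⟩ := Finite.exists_ne_map_eq_of_infinite
    (fun n : ℕ => (⟨f, Algebra.self_mem_adjoin_singleton k f⟩ : Algebra.adjoin k {f}) ^ n)
  have h' : f ^ m = f ^ n := congrArg Subtype.val h
  have h1 := congrArg (fun g : C.K => C.X.ord g x.1) h'
  simp only [ord_pow] at h1
  have h2 : ((m : ℤ) - n) * C.X.ord f x.1 = 0 := by linarith
  rcases mul_eq_zero.mp h2 with h3 | h3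
  · exact absurd (by exact_mod_cast sub_eq_zero.mp h3) hmn
  · exact h3

/-- The function field is finite over a rational function field in one variable. -/
theorem exists_parameter (x : C.ClosedPoint) : ∃ (t : C.K) (r : ℕ) (u : Fin r → C.K),
    (∀ q : Polynomial k, q ≠ 0 → Polynomial.aeval t q ≠ 0) ∧
    ∀ g : C.K, ∃ q : Polynomial k, q ≠ 0 ∧ ∃ p : Fin r → Polynomial k,
      Polynomial.aeval t q * g = ∑ i, Polynomial.aeval t (p i) * u i := by
  obtain ⟨V, hV, hx⟩ := C.exists_affine_mem x.1
  have hne : Nonempty V := ⟨⟨_, hx⟩⟩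
  have hft := C.finiteType_sections hV
  have hfrac := functionField_isFractionRing_of_isAffineOpen C.X V hV
  -- Noether normalization. The dimension bound gives s ≤ 1; s = 0 would make K algebraic over k,
  -- leaving no function of order one at x.
  obtain ⟨s, g, hinj, hfin⟩ := exists_finite_inj_algHom_of_fg k Γ(C.X, V)
  let algA : Algebra (MvPolynomial (Fin s) k) Γ(C.X, V) := g.toRingHom.toAlgebra
  have hfin' : Module.Finite (MvPolynomial (Fin s) k) Γ(C.X, V) := hfin
  have hint : Algebra.IsIntegral (MvPolynomial (Fin s) k) Γ(C.X, V) := inferInstance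
  have hfaith : FaithfulSMul (MvPolynomial (Fin s) k) Γ(C.X, V) :=
    (faithfulSMul_iff_algebraMap_injective _ _).mpr hinj
  have hdim := ringKrullDim_sections_le hV
  have hdim' := krullDimLE_one_of_isIntegral (MvPolynomial (Fin s) k) Γ(C.X, V)
  rw [Ring.krullDimLE_iff, MvPolynomial.ringKrullDim_of_isNoetherianRing,
    ringKrullDim_eq_zero_of_field, zero_add] at hdim'
  have hs1 : s ≤ 1 := by simpa using hdim'
  have htower : IsScalarTower k (MvPolynomial (Fin s) k) Γ(C.X, V) :=
    IsScalarTower.of_algebraMap_eq fun c => (g.commutes c).symm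
  have hs0 : s ≠ 0 := by
    rintro rfl
    have h1 : Algebra.IsIntegral k Γ(C.X, V) := by
      have : Algebra.IsIntegral k (MvPolynomial (Fin 0) k) :=
        ⟨fun p => by
          rw [MvPolynomial.eq_C_of_isEmpty p]
          exact isIntegral_algebraMap⟩
      exact Algebra.IsIntegral.trans (MvPolynomial (Fin 0) k)
    obtain ⟨ϖ, -, hϖ⟩ := exists_uniformizer x
    obtain ⟨a, b, -, rfl⟩ := IsFractionRing.div_surjective (A := Γ(C.X, V)) ϖ
    have ha : IsIntegral k (algebraMap Γ(C.X, V) C.K a) := (Algebra.IsIntegral.isIntegral a).algebraMap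
    have hb : IsIntegral k (algebraMap Γ(C.X, V) C.K b) := (Algebra.IsIntegral.isIntegral b).algebraMap
    rw [div_eq_mul_inv, ord_eq_zero_of_isIntegral x (ha.mul hb.inv)] at hϖ
    exact zero_ne_one hϖ
  obtain rfl : s = 1 := by omega
  let e := MvPolynomial.uniqueAlgEquiv k (Fin 1)
  have he : ∀ q : Polynomial k, Polynomial.aeval (algebraMap Γ(C.X, V) C.K (g (MvPolynomial.X 0))) q =
      algebraMap Γ(C.X, V) C.K (g (e.symm q)) := by
    intro q
    have h1 : Polynomial.aeval (algebraMap Γ(C.X, V) C.K (g (MvPolynomial.X 0))) =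
        ((IsScalarTower.toAlgHom k Γ(C.X, V) C.K).comp g).comp (e.symm : _ →ₐ[k] _) := by
      ext
      simp [e]
    exact DFunLike.congr_fun h1 q
  obtain ⟨r, w, hw⟩ := Module.Finite.exists_fin (R := MvPolynomial (Fin 1) k) (M := Γ(C.X, V))
  have hK : Function.Injective (algebraMap Γ(C.X, V) C.K) := IsFractionRing.injective _ _
  refine ⟨algebraMap Γ(C.X, V) C.K (g (MvPolynomial.X 0)), r,
    fun i => algebraMap Γ(C.X, V) C.K (w i), fun q hq => ?_, fun f => ?_⟩
  · rw [he]
    simpa [map_eq_zero_iff _ hK, map_eq_zero_iff _ hinj] using hq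
  · obtain ⟨a, b, hb, rfl⟩ := IsFractionRing.div_surjective (A := Γ(C.X, V)) f
    have hb0 : b ≠ 0 := nonZeroDivisors.ne_zero hb
    -- By integrality the denominator `b` has a nonzero multiple in k[t], so denominators can be
    -- taken in k[t].
    have hI := Ideal.comap_ne_bot_of_integral_mem (R := MvPolynomial (Fin 1) k) hb0
      (Ideal.mem_span_singleton_self b) (Algebra.IsIntegral.isIntegral b)
    obtain ⟨c, hc, hc0⟩ := Submodule.exists_mem_ne_zero_of_ne_bot hI
    obtain ⟨a', ha'⟩ := Ideal.mem_span_singleton.mp (Ideal.mem_comap.mp hc)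
    have hmem : a' * a ∈ Submodule.span (MvPolynomial (Fin 1) k) (Set.range w) := hw ▸ trivial
    obtain ⟨p, hp⟩ := (Submodule.mem_span_range_iff_exists_fun _).mp hmem
    refine ⟨e c, by simpa using hc0, fun i => e (p i), ?_⟩
    have hbK : algebraMap Γ(C.X, V) C.K b ≠ 0 := by simpa [map_eq_zero_iff _ hK] using hb0
    simp only [he, AlgEquiv.symm_apply_apply]
    have hgc : g c = b * a' := ha'
    rw [hgc, ← mul_div_assoc, div_eq_iff hbK, ← map_mul]
    have : ∑ i, algebraMap Γ(C.X, V) C.K (g (p i)) * algebraMap Γ(C.X, V) C.K (w i) =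
        algebraMap Γ(C.X, V) C.K (a' * a) := by
      rw [← hp, map_sum]
      refine Finset.sum_congr rfl fun i _ => ?_
      rw [← map_mul, Algebra.smul_def]
      rfl
    rw [this, ← map_mul]
    congr 1
    ring

end SmoothProjectiveCurve

/-! ### Approximation and partial fractions: every adele is bounded modulo principal adeles -/

/-- A nonzero polynomial factors into a part supported at `b` and a part coprime to `b`. -/
theorem Polynomial.exists_dvd_pow_mul_isCoprime {k : Type*} [Field k] (b : Polynomial k)
    {q : Polynomial k} (hq : q ≠ 0) :
    ∃ q₁ q₂ : Polynomial k, q = q₁ * q₂ ∧ (∃ N : ℕ, q₁ ∣ b ^ N) ∧ IsCoprime q₂ b := by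
  induction hn : q.natDegree using Nat.strong_induction_on generalizing q with
  | _ n ih =>
    by_cases hc : IsCoprime q b
    · exact ⟨1, q, (one_mul q).symm, ⟨0, one_dvd _⟩, hc⟩
    classical
    obtain ⟨q', hq'⟩ := EuclideanDomain.gcd_dvd_left q b
    have hd0 : EuclideanDomain.gcd q b ≠ 0 := fun h => hq (by rw [hq', h, zero_mul])
    have hq0 : q' ≠ 0 := by
      rintro rfl
      exact hq (by simpa using hq')
    have hdeg : (EuclideanDomain.gcd q b).natDegree ≠ 0 := fun h => hc <|
      EuclideanDomain.gcd_isUnit_iff.mp <| by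
        rw [Polynomial.isUnit_iff_degree_eq_zero, Polynomial.degree_eq_natDegree hd0, h]; rfl
    have hsum : q.natDegree = (EuclideanDomain.gcd q b).natDegree + q'.natDegree := by
      conv_lhs => rw [hq']
      exact Polynomial.natDegree_mul hd0 hq0
    obtain ⟨q₁, q₂, h1, ⟨N, hN⟩, h2⟩ := ih q'.natDegree (by omega) hq0 rfl
    refine ⟨EuclideanDomain.gcd q b * q₁, q₂, ?_, ⟨N + 1, ?_⟩, h2⟩
    · rw [mul_assoc, ← h1, ← hq']
    · rw [pow_succ']
      exact mul_dvd_mul (EuclideanDomain.gcd_dvd_right q b) hN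

namespace SmoothProjectiveCurve

variable {k : Type u} [Field k] {C : SmoothProjectiveCurve k} [Finite k]

/-- The absolute value of the function field attached to a closed point. -/
def absoluteValue (x : C.ClosedPoint) : AbsoluteValue C.K ℝ where
  toFun f := by
    classical
    -- The order of the zero function is 0 by convention, so zero is treated separately. Any base
    -- greater than 1 would serve.
    exact if f = 0 then 0 else (2 : ℝ) ^ (-C.X.ord f x.1)
  map_mul' f g := by
    by_cases hf : f = 0
    · simp [hf]
    by_cases hg : g = 0
    · simp [hg]
    simp only [mul_eq_zero, hf, hg, or_self, if_false]
    rw [Scheme.ord_mul hf hg, neg_add, zpow_add₀ two_ne_zero]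
  nonneg' f := by
    split_ifs
    · exact le_rfl
    · positivity
  eq_zero' f := by
    constructor
    · intro h
      by_contra hf
      rw [if_neg hf] at h
      exact absurd h (by positivity)
    · rintro rfl
      simp
  add_le' f g := by
    by_cases hf : f = 0
    · subst hf
      rw [zero_add]
      simp
    by_cases hg : g = 0
    · subst hg
      rw [add_zero]
      simp
    by_cases hfg : f + g = 0
    · simp only [hfg, if_true]
      rw [if_neg hf, if_neg hg]
      positivity
    simp only [hf, hg, hfg, if_false]
    rcases min_le_iff.mp (min_ord_le_ord_add C.π x.1 hfg) with h | h
    · have h1 : (2 : ℝ) ^ (-C.X.ord (f + g) x.1) ≤ 2 ^ (-C.X.ord f x.1) :=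
        zpow_le_zpow_right₀ one_le_two (by linarith)
      have h2 : (0 : ℝ) ≤ 2 ^ (-C.X.ord g x.1) := by positivity
      linarith
    · have h1 : (2 : ℝ) ^ (-C.X.ord (f + g) x.1) ≤ 2 ^ (-C.X.ord g x.1) :=
        zpow_le_zpow_right₀ one_le_two (by linarith)
      have h2 : (0 : ℝ) ≤ 2 ^ (-C.X.ord f x.1) := by positivity
      linarith

theorem absoluteValue_apply (x : C.ClosedPoint) {f : C.K} (hf : f ≠ 0) :
    absoluteValue x f = 2 ^ (-C.X.ord f x.1) := by
  exact if_neg hf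

theorem absoluteValue_le_one_iff (x : C.ClosedPoint) (f : C.K) :
    absoluteValue x f ≤ 1 ↔ f ∈ localSections (0 : C.Divisor) x := by
  rw [mem_localSections_iff]
  by_cases hf : f = 0
  · simp [hf]
  rw [absoluteValue_apply x hf, zpow_le_one_iff_right₀ one_lt_two]
  simp [hf]

theorem absoluteValue_isNontrivial (x : C.ClosedPoint) : (absoluteValue x).IsNontrivial := by
  obtain ⟨ϖ, h0, h1⟩ := exists_uniformizer x
  refine ⟨ϖ, h0, ?_⟩
  rw [absoluteValue_apply x h0, h1]
  norm_num

/-- Equivalent absolute values have the same closed unit ball, that is, the same local ring, and the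
local ring determines the closed point. -/
theorem not_isEquiv_absoluteValue {x y : C.ClosedPoint} (hxy : x ≠ y) :
    ¬ (absoluteValue x).IsEquiv (absoluteValue y) := by
  intro h
  refine hxy (eq_of_range_stalk_le fun f hf => ?_)
  rw [mem_range_stalk_iff] at hf ⊢
  have := (absoluteValue_le_one_iff y f).mp
    (h.le_one_iff.mp ((absoluteValue_le_one_iff x f).mpr (by simpa [mem_localSections_iff] using hf)))
  simpa [mem_localSections_iff] using this

/-- Weak approximation at finitely many closed points. -/
theorem exists_sub_mem_localSections {S : Set C.ClosedPoint} (hS : S.Finite)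
    (ρ : C.ClosedPoint → C.K) :
    ∃ g : C.K, ∀ x ∈ S, ρ x - g ∈ localSections (0 : C.Divisor) x := by
  have := hS.to_subtype
  have := Fintype.ofFinite S
  have hd := AbsoluteValue.denseRange_algebraMap_pi (v := fun x : S => absoluteValue x.1)
    (fun x => absoluteValue_isNontrivial x.1)
    (fun x y hxy => not_isEquiv_absoluteValue fun h => hxy (Subtype.ext h))
  obtain ⟨g, hg⟩ := Metric.denseRange_iff.mp hd (fun x => WithAbs.toAbs _ (ρ x.1)) 1 one_pos
  refine ⟨g, fun x hx => ?_⟩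
  rw [dist_pi_lt_iff one_pos] at hg
  have h := hg ⟨x, hx⟩
  rw [dist_eq_norm] at h
  exact (absoluteValue_le_one_iff x _).mp h.le

theorem mul_mem_localSections_zero {D : C.Divisor} {x : C.ClosedPoint} {f g : C.K}
    (hf : f ∈ localSections D x) (hg : g ∈ localSections (0 : C.Divisor) x) :
    f * g ∈ localSections D x := by
  simpa using mul_mem_localSections hf hg

theorem algebraMap_mem_localSections (x : C.ClosedPoint) (c : k) :
    algebraMap k C.K c ∈ localSections (0 : C.Divisor) x := by
  rw [mem_localSections_iff, ord_algebraMap]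
  simp

theorem algebraMap_notMem_localSections (x : C.ClosedPoint) {c : k} (hc : c ≠ 0) :
    algebraMap k C.K c ∉ localSections (-Finsupp.single x 1) x := by
  rw [mem_localSections_iff, ord_algebraMap]
  simp [hc]

theorem pow_mem_localSections_zero {x : C.ClosedPoint} {f : C.K}
    (hf : f ∈ localSections (0 : C.Divisor) x) (n : ℕ) :
    f ^ n ∈ localSections (0 : C.Divisor) x := by
  induction n with
  | zero => simpa using algebraMap_mem_localSections x 1
  | succ n ih =>
    rw [pow_succ]
    exact mul_mem_localSections_zero ih hf

theorem aeval_mem_localSections_zero {x : C.ClosedPoint} {f : C.K}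
    (hf : f ∈ localSections (0 : C.Divisor) x) (p : Polynomial k) :
    Polynomial.aeval f p ∈ localSections (0 : C.Divisor) x := by
  rw [Polynomial.aeval_eq_sum_range]
  exact sum_mem fun i _ => Submodule.smul_mem _ _ (pow_mem_localSections_zero hf i)

theorem inv_mem_localSections_zero {x : C.ClosedPoint} {f : C.K}
    (hf : f ∉ localSections (-Finsupp.single x 1) x) :
    f⁻¹ ∈ localSections (0 : C.Divisor) x := by
  rw [mem_localSections_iff, not_or] at hf
  refine mem_localSections_iff.mpr (Or.inr ?_)
  have h := hf.2
  rw [ord_inv]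
  simp at h ⊢
  omega

theorem inv_mem_localSections_neg {x : C.ClosedPoint} {f : C.K}
    (hf : f ∉ localSections (0 : C.Divisor) x) :
    f⁻¹ ∈ localSections (-Finsupp.single x 1) x := by
  rw [mem_localSections_iff, not_or] at hf
  refine mem_localSections_iff.mpr (Or.inr ?_)
  have h := hf.2
  rw [ord_inv]
  simp at h ⊢
  omega

/-- At a pole of `t`, a rational expression in `t` of nonpositive degree is regular. -/
theorem aeval_div_aeval_mem_localSections {x : C.ClosedPoint} {t : C.K}
    (ht : t ∉ localSections (0 : C.Divisor) x) {w q : Polynomial k} (hq : q ≠ 0)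
    (hw : w.natDegree ≤ q.natDegree) :
    Polynomial.aeval t w / Polynomial.aeval t q ∈ localSections (0 : C.Divisor) x := by
  have ht0 : t ≠ 0 := fun h => ht (h ▸ zero_mem _)
  have hs' := inv_mem_localSections_neg ht
  have hs : t⁻¹ ∈ localSections (0 : C.Divisor) x :=
    localSections_mono (by simp) hs'
  have key : ∀ (n : ℕ) (p : Polynomial k), p.natDegree ≤ n →
      Polynomial.aeval t p * t⁻¹ ^ n ∈ localSections (0 : C.Divisor) x := by
    intro n p hp
    rw [Polynomial.aeval_eq_sum_range' (Nat.lt_succ_of_le hp), Finset.sum_mul]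
    refine sum_mem fun i hi => ?_
    rw [smul_mul_assoc]
    refine Submodule.smul_mem _ _ ?_
    obtain ⟨m, rfl⟩ := Nat.exists_eq_add_of_le (Nat.lt_succ_iff.mp (Finset.mem_range.mp hi))
    rw [pow_add, ← mul_assoc, ← mul_pow, mul_inv_cancel₀ ht0, one_pow, one_mul]
    exact pow_mem_localSections_zero hs m
  -- After scaling by t^(-deg q) the denominator is congruent to its nonzero leading coefficient
  -- modulo the maximal ideal, hence a unit.
  have hlead : Polynomial.aeval t q * t⁻¹ ^ q.natDegree ∉
      localSections (-Finsupp.single x 1) x := by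
    intro hmem
    refine algebraMap_notMem_localSections x (Polynomial.leadingCoeff_ne_zero.mpr hq) ?_
    have e : algebraMap k C.K q.leadingCoeff = Polynomial.aeval t q * t⁻¹ ^ q.natDegree -
        Polynomial.aeval t q.eraseLead * t⁻¹ ^ q.natDegree := by
      have h := congrArg (Polynomial.aeval t) q.eraseLead_add_C_mul_X_pow
      simp only [map_add, map_mul, map_pow, Polynomial.aeval_C, Polynomial.aeval_X] at h
      rw [← h, add_mul, add_sub_cancel_left, mul_assoc, ← mul_pow, mul_inv_cancel₀ ht0, one_pow, mul_one]
    rw [e]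
    refine sub_mem hmem ?_
    by_cases h0 : q.natDegree = 0
    · rw [Polynomial.eq_C_of_natDegree_eq_zero h0, Polynomial.eraseLead_C]
      simp
    · obtain ⟨m, hm⟩ := Nat.exists_eq_succ_of_ne_zero h0
      have h1 := key m q.eraseLead (by have := q.eraseLead_natDegree_le; omega)
      rw [hm, pow_succ', ← mul_assoc, mul_right_comm, mul_comm]
      exact mul_mem_localSections_zero hs' h1
  have e : Polynomial.aeval t w / Polynomial.aeval t q =
      (Polynomial.aeval t w * t⁻¹ ^ q.natDegree) *
        (Polynomial.aeval t q * t⁻¹ ^ q.natDegree)⁻¹ := by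
    rw [mul_inv, mul_mul_mul_comm, mul_inv_cancel₀ (pow_ne_zero _ (inv_ne_zero ht0)), mul_one,
      div_eq_mul_inv]
  rw [e]
  exact mul_mem_localSections_zero (key _ w hw) (inv_mem_localSections_zero hlead)

/-- The witness is the minimal polynomial over k of the residue of t at x. -/
theorem exists_aeval_mem_localSections_neg {x : C.ClosedPoint} {t : C.K}
    (ht : t ∈ localSections (0 : C.Divisor) x) :
    ∃ b : Polynomial k, b ≠ 0 ∧ Polynomial.aeval t b ∈ localSections (-Finsupp.single x 1) x := by
  obtain ⟨t, rfl⟩ := (mem_range_stalk_iff x t).mpr (by simpa [mem_localSections_iff] using ht)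
  have hint : IsIntegral k (residue _ t) := Algebra.IsIntegral.isIntegral _
  refine ⟨minpoly k (residue _ t), minpoly.ne_zero hint, ?_⟩
  rw [Polynomial.aeval_algebraMap_apply, mem_localSections_iff]
  by_cases h0 : Polynomial.aeval t (minpoly k (residue _ t)) = 0
  · simp [h0]
  have h1 := ord_nonneg_of_stalk x (Polynomial.aeval t (minpoly k (residue _ t)))
  have h2 : ¬ IsUnit (Polynomial.aeval t (minpoly k (residue _ t))) := by
    rw [← mem_nonunits_iff, ← mem_maximalIdeal, ← residue_eq_zero_iff]
    have := minpoly.aeval k (residue _ t)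
    rwa [← ResidueField.algebraMap_eq, Polynomial.aeval_algebraMap_apply] at this
  rw [isUnit_iff_ord_eq_zero x h0] at h2
  refine Or.inr ?_
  simp
  omega

/-- The adeles are covered by a single divisor modulo principal adeles. -/
theorem exists_adeles_le : ∃ E : C.Divisor, adeles C ≤ adelesOf E ⊔ principalAdeles C := by
  rcases isEmpty_or_nonempty C.ClosedPoint with hemp | ⟨⟨x₀⟩⟩
  · refine ⟨0, fun ρ _ => Submodule.mem_sup_left fun x => hemp.elim x⟩
  obtain ⟨t, r, u, htr, hu⟩ := exists_parameter x₀
  have ht0 : t ≠ 0 := by simpa using htr Polynomial.X Polynomial.X_ne_zero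
  have hE : (Function.support fun x : C.ClosedPoint => ∑ i, |C.X.ord (u i) x.1|).Finite := by
    refine (Set.finite_iUnion fun i => ?_ :
      (⋃ i, {x : C.ClosedPoint | C.X.ord (u i) x.1 ≠ 0}).Finite).subset fun x hx => ?_
    · by_cases h : u i = 0
      · simp [h]
      · exact finite_ord_ne_zero h
    · obtain ⟨i, -, hi⟩ := Finset.exists_ne_zero_of_sum_ne_zero hx
      exact Set.mem_iUnion.mpr ⟨i, by simpa using hi⟩
  -- `E` bounds the poles of all generators `u i` of K over k(t). It does not depend on the adele ρ.
  let E : C.Divisor := Finsupp.ofSupportFinite _ hE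
  have hE0 : ∀ x, 0 ≤ E x := fun x => by
    change 0 ≤ ∑ i, |C.X.ord (u i) x.1|
    positivity
  have huE : ∀ i x, u i ∈ localSections E x := fun i x => by
    refine mem_localSections_iff.mpr (Or.inr ?_)
    have h1 : |C.X.ord (u i) x.1| ≤ E x :=
      Finset.single_le_sum (f := fun i => |C.X.ord (u i) x.1|) (fun i _ => abs_nonneg _)
        (Finset.mem_univ i)
    have := neg_abs_le (C.X.ord (u i) x.1)
    linarith
  refine ⟨E, fun ρ hρ => ?_⟩
  have hloc : ∀ x : C.ClosedPoint, ∃ b : Polynomial k, b ≠ 0 ∧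
      (t ∈ localSections (0 : C.Divisor) x →
        Polynomial.aeval t b ∈ localSections (-Finsupp.single x 1) x) := by
    intro x
    by_cases h : t ∈ localSections (0 : C.Divisor) x
    · obtain ⟨b, hb0, hb⟩ := exists_aeval_mem_localSections_neg h
      exact ⟨b, hb0, fun _ => hb⟩
    · exact ⟨1, one_ne_zero, fun h' => absurd h' h⟩
  choose β hβ0 hβ using hloc
  have hS₀ : {x | ρ x ∉ localSections (0 : C.Divisor) x}.Finite := hρ
  obtain ⟨b, hb0, hb⟩ : ∃ b : Polynomial k, b ≠ 0 ∧ ∀ x,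
      ρ x ∉ localSections (0 : C.Divisor) x → t ∈ localSections (0 : C.Divisor) x →
        Polynomial.aeval t b ∈ localSections (-Finsupp.single x 1) x := by
    refine ⟨∏ x ∈ hS₀.toFinset, β x, Finset.prod_ne_zero_iff.mpr fun x _ => hβ0 x,
      fun x hx ht => ?_⟩
    obtain ⟨b', hb'⟩ := Finset.dvd_prod_of_mem β (hS₀.mem_toFinset.mpr hx)
    rw [hb', map_mul]
    exact mul_mem_localSections_zero (hβ x ht) (aeval_mem_localSections_zero ht b')
  -- `S` consists of the poles of t and the zeros of b(t). It is finite and contains every point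
  -- where ρ is not regular.
  let S : Set C.ClosedPoint := {x | t ∈ localSections (0 : C.Divisor) x →
    Polynomial.aeval t b ∈ localSections (-Finsupp.single x 1) x}
  have hS : S.Finite := by
    refine ((finite_ord_ne_zero ht0).union (finite_ord_ne_zero (htr b hb0))).subset fun x hx => ?_
    by_contra hcon
    simp only [Set.mem_union, Set.mem_ofPred_eq, not_or, not_not] at hcon
    have h1 := hx (mem_localSections_iff.mpr (Or.inr (by simp [hcon.1])))
    rw [mem_localSections_iff, hcon.2] at h1
    simp [htr b hb0] at h1
  obtain ⟨g, hg⟩ := exists_sub_mem_localSections hS ρ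
  obtain ⟨q, hq0, p, hp⟩ := hu g
  obtain ⟨q₁, q₂, rfl, ⟨N, hN⟩, hcop⟩ := Polynomial.exists_dvd_pow_mul_isCoprime b hq0
  obtain ⟨h10, h20⟩ := mul_ne_zero_iff.mp hq0
  obtain ⟨A, B, hAB⟩ := (hcop.pow_right (n := N)).of_isCoprime_of_dvd_right hN
  -- Partial fractions p_i/(q₁q₂) = w_i/q₂ + e_i/q₁. The terms e_i/q₁ are regular off S, since b(t)
  -- is a unit there. The terms w_i/q₂ are regular on S: at zeros of b(t) by coprimality, at poles
  -- of t by the degree bound. So subtracting only g' = Σ u_i e_i/q₁ brings ρ into the adeles of E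
  -- at every point.
  have hwe : ∀ i, ∃ w e : Polynomial k, p i = w * q₁ + e * q₂ ∧ w.natDegree ≤ q₂.natDegree := by
    intro i
    refine ⟨(p i * B) % q₂, p i * A + (p i * B) / q₂ * q₁, ?_, ?_⟩
    · have h := EuclideanDomain.div_add_mod (p i * B) q₂
      linear_combination (-p i) * hAB - q₁ * h
    · exact Polynomial.natDegree_le_natDegree (Polynomial.degree_mod_lt _ h20).le
  choose w e hpe hwdeg using hwe
  have h1t := htr q₁ h10
  have h2t := htr q₂ h20
  let g' : C.K := ∑ i, u i * (Polynomial.aeval t (e i) / Polynomial.aeval t q₁)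
  have hgg : g - g' = ∑ i, u i * (Polynomial.aeval t (w i) / Polynomial.aeval t q₂) := by
    rw [sub_eq_iff_eq_add, ← Finset.sum_add_distrib]
    rw [map_mul] at hp
    refine mul_left_cancel₀ (mul_ne_zero h1t h2t) (hp.trans ?_)
    rw [Finset.mul_sum]
    refine Finset.sum_congr rfl fun i _ => ?_
    rw [hpe i]
    simp only [map_add, map_mul]
    field_simp
  rw [← sub_add_cancel ρ (fun _ => g')]
  refine Submodule.add_mem_sup (fun x _ => ?_) ⟨g', rfl⟩
  change ρ x - g' ∈ localSections E x
  have h0E : localSections (0 : C.Divisor) x ≤ localSections E x := localSections_mono (hE0 x)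
  by_cases hx : x ∈ S
  · rw [← sub_add_sub_cancel (ρ x) g g']
    refine add_mem (h0E (hg x hx)) ?_
    rw [hgg]
    refine sum_mem fun i _ => mul_mem_localSections_zero (huE i x) ?_
    by_cases ht : t ∈ localSections (0 : C.Divisor) x
    · rw [div_eq_mul_inv]
      refine mul_mem_localSections_zero (aeval_mem_localSections_zero ht _)
        (inv_mem_localSections_zero fun hcon => ?_)
      obtain ⟨a', b', hab⟩ := hcop
      refine algebraMap_notMem_localSections x (one_ne_zero (α := k)) ?_
      rw [map_one, ← map_one (Polynomial.aeval (R := k) t), ← hab, map_add, map_mul, map_mul,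
        mul_comm, mul_comm (Polynomial.aeval t b')]
      exact add_mem (mul_mem_localSections_zero hcon (aeval_mem_localSections_zero ht _))
        (mul_mem_localSections_zero (hx ht) (aeval_mem_localSections_zero ht _))
    · exact aeval_div_aeval_mem_localSections ht h20 (hwdeg i)
  · simp only [S, Set.mem_ofPred_eq, Classical.not_imp] at hx
    obtain ⟨ht, hbt⟩ := hx
    refine sub_mem (h0E ?_) (sum_mem fun i _ => mul_mem_localSections_zero (huE i x) ?_)
    · by_contra h
      exact hbt (hb x h ht)
    · rw [div_eq_mul_inv]
      refine mul_mem_localSections_zero (aeval_mem_localSections_zero ht _) ?_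
      obtain ⟨c, hc⟩ := hN
      have hbN : (Polynomial.aeval t q₁)⁻¹ =
          (Polynomial.aeval t b)⁻¹ ^ N * Polynomial.aeval t c := by
        have := congrArg (Polynomial.aeval t) hc
        rw [map_pow, map_mul] at this
        rw [inv_pow, this, mul_inv]
        have : Polynomial.aeval t c ≠ 0 := htr c (by
          rintro rfl
          exact pow_ne_zero N hb0 (by simpa using hc))
        field_simp
      rw [hbN]
      exact mul_mem_localSections_zero
        (pow_mem_localSections_zero (inv_mem_localSections_zero hbt) N)
        (aeval_mem_localSections_zero ht c)

end SmoothProjectiveCurve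

/-! ### Adelic cohomology: finiteness, Riemann–Roch and vanishing -/

/-- Dimension count in an exact sequence `0 → V₀ → V₁ → κ → W₀ → W₁ → 0` with `κ` finite. -/
theorem finrank_of_fiveTerm_exact {k V₀ V₁ κ W₀ W₁ : Type*} [Field k] [AddCommGroup V₀]
    [Module k V₀] [AddCommGroup V₁] [Module k V₁] [AddCommGroup κ] [Module k κ] [Module.Finite k κ]
    [AddCommGroup W₀] [Module k W₀] [AddCommGroup W₁] [Module k W₁]
    {i : V₀ →ₗ[k] V₁} {ρ : V₁ →ₗ[k] κ} {τ : κ →ₗ[k] W₀} {π : W₀ →ₗ[k] W₁}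
    (hi : Function.Injective i) (hρ : Function.Exact i ρ) (hτ : Function.Exact ρ τ)
    (hπ : Function.Exact τ π) (hs : Function.Surjective π) :
    (Module.Finite k V₀ ↔ Module.Finite k V₁) ∧ (Module.Finite k W₀ ↔ Module.Finite k W₁) ∧
    (Module.Finite k V₀ → Module.Finite k W₀ →
      (Module.finrank k V₁ : ℤ) - Module.finrank k W₁ =
        Module.finrank k V₀ - Module.finrank k W₀ + Module.finrank k κ) := by
  have kρ : LinearMap.ker ρ = LinearMap.range i := hρ.linearMap_ker_eq
  have kτ : LinearMap.ker τ = LinearMap.range ρ := hτ.linearMap_ker_eq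
  have kπ : LinearMap.ker π = LinearMap.range τ := hπ.linearMap_ker_eq
  have fV : Module.Finite k V₀ ↔ Module.Finite k V₁ := by
    constructor
    · intro h
      refine ⟨Submodule.fg_of_fg_map_of_fg_inf_ker ρ (IsNoetherian.noetherian _) ?_⟩
      rw [top_inf_eq, kρ, LinearMap.range_eq_map]
      exact h.fg_top.map i
    · intro h
      exact Module.Finite.of_injective i hi
  have fW : Module.Finite k W₀ ↔ Module.Finite k W₁ := by
    constructor
    · intro h
      exact Module.Finite.of_surjective π hs
    · intro h
      refine ⟨Submodule.fg_of_fg_map_of_fg_inf_ker π (IsNoetherian.noetherian _) ?_⟩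
      rw [top_inf_eq, kπ, LinearMap.range_eq_map]
      exact (Module.Finite.fg_top (R := k) (M := κ)).map τ
  refine ⟨fV, fW, fun h0 h1 => ?_⟩
  have := fV.mp h0
  have := fW.mp h1
  have e1 := LinearMap.finrank_range_add_finrank_ker ρ
  have e2 := LinearMap.finrank_range_add_finrank_ker τ
  have e3 := LinearMap.finrank_range_add_finrank_ker π
  rw [kρ, LinearMap.finrank_range_of_inj hi] at e1
  rw [kτ] at e2
  rw [kπ, LinearMap.range_eq_top.mpr hs, finrank_top] at e3
  omega


namespace SmoothProjectiveCurve

variable {k : Type u} [Field k] {C : SmoothProjectiveCurve k}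

namespace Divisor

theorem deg_add (D E : C.Divisor) : (D + E).deg = D.deg + E.deg :=
  Finsupp.sum_add_index' (fun _ => zero_mul _) fun _ _ _ => add_mul _ _ _

theorem deg_zero : (0 : C.Divisor).deg = 0 := Finsupp.sum_zero_index

theorem deg_neg (D : C.Divisor) : (-D).deg = -D.deg := by
  have h := deg_add D (-D)
  rw [add_neg_cancel, deg_zero] at h
  linarith

theorem deg_sub (D E : C.Divisor) : (D - E).deg = D.deg - E.deg := by
  rw [sub_eq_add_neg, deg_add, deg_neg, sub_eq_add_neg]

theorem deg_nsmul (n : ℕ) (D : C.Divisor) : (n • D).deg = n * D.deg := by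
  induction n with
  | zero => simp [deg_zero]
  | succ n ih => rw [succ_nsmul, deg_add, ih]; push_cast; ring

theorem deg_single (x : C.ClosedPoint) (n : ℤ) :
    Divisor.deg (Finsupp.single x n : C.Divisor) = n * C.pointDegree x :=
  Finsupp.sum_single_index (zero_mul _)

/-- Two divisors are connected by adding and removing closed points. -/
theorem induction_step {P : C.Divisor → Prop} (h : ∀ D x, P D ↔ P (D + Finsupp.single x 1))
    {D : C.Divisor} (hD : P D) (E : C.Divisor) : P E := by
  have h1 : ∀ F D : C.Divisor, P D → P (D + F) := by
    intro F
    induction F using Finsupp.induction_linear with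
    | zero => exact fun D hD => by rwa [add_zero]
    | add F G hF hG => exact fun D hD => by rw [← add_assoc]; exact hG _ (hF _ hD)
    | single x n =>
      intro D hD
      induction n using Int.induction_on with
      | zero => simpa using hD
      | succ n ih => rwa [Finsupp.single_add, ← add_assoc, ← h]
      | pred n ih =>
        rw [h _ x, add_assoc, ← Finsupp.single_add, sub_add_cancel]
        exact ih
  simpa using h1 (E - D) D hD

end Divisor

theorem mem_principalAdeles {r : C.ClosedPoint → C.K} :
    r ∈ principalAdeles C ↔ ∃ g : C.K, (fun _ => g) = r := Iff.rfl

variable [Finite k]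

theorem mem_adelesOf {D : C.Divisor} {r : C.ClosedPoint → C.K} :
    r ∈ adelesOf D ↔ ∀ x, r x ∈ localSections D x := by
  simp [adelesOf]

theorem adelesOf_mono {D E : C.Divisor} (h : D ≤ E) : adelesOf D ≤ adelesOf E := fun _ hr =>
  mem_adelesOf.mpr fun x => localSections_mono (h x) (mem_adelesOf.mp hr x)

theorem adelesOf_le_adeles (D : C.Divisor) : adelesOf D ≤ adeles C := fun _ hr => by
  refine (D.support.finite_toSet).subset fun x hx => ?_
  by_contra h
  have h0 : D x = (0 : C.Divisor) x := by simpa using h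
  exact hx (localSections_congr h0 ▸ mem_adelesOf.mp hr x)

theorem smul_mem_adeles (f : C.K) {r : C.ClosedPoint → C.K} (hr : r ∈ adeles C) :
    f • r ∈ adeles C := by
  by_cases hf : f = 0
  · rw [hf, zero_smul]
    exact zero_mem _
  have hr' : {x | r x ∉ localSections (0 : C.Divisor) x}.Finite := hr
  refine (hr'.union (finite_ord_ne_zero hf)).subset fun x hx => ?_
  by_contra h
  simp only [Set.mem_union, Set.mem_ofPred_eq, not_or, not_not] at h
  refine hx ?_
  rw [Pi.smul_apply, smul_eq_mul]
  exact mul_mem_localSections_zero (mem_localSections_iff.mpr (Or.inr (by simp [h.2]))) h.1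

theorem single_mem_adeles [DecidableEq C.ClosedPoint] (x : C.ClosedPoint) (f : C.K) :
    Pi.single x f ∈ adeles C := by
  refine (Set.finite_singleton x).subset fun y hy => ?_
  by_contra h
  exact hy (by rw [Pi.single_eq_of_ne h]; exact zero_mem _)

/-- This is how vanishing in H¹ is used throughout: one rational function solves all the local
approximation conditions at once. -/
theorem mk_H1_eq_zero_iff {D : C.Divisor} (r : adeles C) :
    (Submodule.Quotient.mk r : H1 D) = 0 ↔
      ∃ g : C.K, ∀ x, r.1 x - g ∈ localSections D x := by
  rw [Submodule.Quotient.mk_eq_zero, Submodule.submoduleOf, Submodule.mem_comap, Submodule.mem_sup]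
  constructor
  · rintro ⟨a, ha, b, hb, h⟩
    obtain ⟨g, rfl⟩ := mem_principalAdeles.mp hb
    refine ⟨g, fun x => ?_⟩
    have h' := congrFun h x
    simp only [Pi.add_apply, Submodule.coe_subtype] at h'
    rw [← h', add_sub_cancel_right]
    exact mem_adelesOf.mp ha x
  · rintro ⟨g, hg⟩
    exact ⟨fun x => r.1 x - g, mem_adelesOf.mpr hg, fun _ => g, ⟨g, rfl⟩, by
      ext x; simp⟩

theorem submoduleOf_mono {D E : C.Divisor} (h : D ≤ E) :
    (adelesOf D ⊔ principalAdeles C).submoduleOf (adeles C) ≤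
      (adelesOf E ⊔ principalAdeles C).submoduleOf (adeles C) :=
  Submodule.comap_mono (sup_le_sup_right (adelesOf_mono h) _)

/-- The effect on cohomology of adding a closed point to a divisor. -/
theorem finrank_add_single (D : C.Divisor) (x : C.ClosedPoint) :
    (Module.Finite k (H0 D) ↔ Module.Finite k (H0 (D + Finsupp.single x 1))) ∧
    (Module.Finite k (H1 D) ↔ Module.Finite k (H1 (D + Finsupp.single x 1))) ∧
    (Module.Finite k (H0 D) → Module.Finite k (H1 D) →
      (Module.finrank k (H0 (D + Finsupp.single x 1)) : ℤ) -
          Module.finrank k (H1 (D + Finsupp.single x 1)) =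
        Module.finrank k (H0 D) - Module.finrank k (H1 D) + C.pointDegree x) := by
  classical
  rw [pointDegree_eq_finrank]
  set D' := D + Finsupp.single x 1 with hD'
  have hle : D ≤ D' := by simp [hD']
  have hoff : ∀ y, y ≠ x → localSections D' y = localSections D y := fun y hy =>
    localSections_congr (by simp [hD', Finsupp.single_eq_of_ne hy])
  obtain ⟨ρ, hρs, hρ⟩ := exists_leadingCoeff D' x
  rw [show D' - Finsupp.single x 1 = D from add_sub_cancel_right _ _] at hρ
  obtain ⟨sec, hsec⟩ := LinearMap.exists_rightInverse_of_surjective ρ (LinearMap.range_eq_top.mpr hρs)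
  have hsec' : ∀ c, ρ (sec c) = c := fun c => LinearMap.congr_fun hsec c
  let i : H0 D →ₗ[k] H0 D' := Submodule.inclusion fun f hf =>
    mem_H0_iff.mpr fun y => localSections_mono (hle y) (mem_H0_iff.mp hf y)
  let j : H0 D' →ₗ[k] localSections D' x := Submodule.inclusion (iInf_le _ x)
  -- The connecting map of 0 → 𝒪(D) → 𝒪(D + x) → κ(x) → 0: lift a leading coefficient to a local
  -- section and take the adele concentrated at x. By `hσsec` the class does not depend on the lift.
  let σ : localSections D' x →ₗ[k] H1 D := Submodule.mkQ _ ∘ₗ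
    LinearMap.codRestrict (adeles C) (LinearMap.single k (fun _ => C.K) x ∘ₗ Submodule.subtype _)
      fun f => single_mem_adeles x f.1
  have hσ : ∀ f, σ f = 0 ↔ ∃ g : H0 D', ρ (j g) = ρ f := by
    intro f
    refine (mk_H1_eq_zero_iff _).trans ⟨?_, ?_⟩
    · rintro ⟨g, hg⟩
      change ∀ y, (Pi.single x (f : C.K) : C.ClosedPoint → C.K) y - g ∈ localSections D y at hg
      have hgx := hg x
      rw [Pi.single_eq_same] at hgx
      have hgm : g ∈ H0 D' := mem_H0_iff.mpr fun y => by
        by_cases hy : y = x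
        · subst hy
          have := sub_mem f.2 (localSections_mono (hle y) hgx)
          rwa [sub_sub_cancel] at this
        · have := hg y
          rw [Pi.single_eq_of_ne hy, zero_sub, neg_mem_iff] at this
          rwa [hoff y hy]
      refine ⟨⟨g, hgm⟩, ?_⟩
      rw [eq_comm, ← sub_eq_zero, ← map_sub, hρ]
      exact hgx
    · rintro ⟨g, hg⟩
      refine ⟨g.1, fun y => ?_⟩
      change (Pi.single x (f : C.K) : C.ClosedPoint → C.K) y - g.1 ∈ localSections D y
      by_cases hy : y = x
      · subst hy
        rw [Pi.single_eq_same]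
        rw [eq_comm, ← sub_eq_zero, ← map_sub, hρ] at hg
        exact hg
      · rw [Pi.single_eq_of_ne hy, zero_sub, neg_mem_iff, ← hoff y hy]
        exact mem_H0_iff.mp g.2 y
  have hσsec : ∀ f, σ (sec (ρ f)) = σ f := by
    intro f
    rw [← sub_eq_zero, ← map_sub, hσ]
    exact ⟨0, by rw [map_sub ρ, hsec', sub_self, map_zero, map_zero]⟩
  refine finrank_of_fiveTerm_exact (i := i) (ρ := ρ ∘ₗ j) (τ := σ ∘ₗ sec)
    (π := Submodule.factor (submoduleOf_mono hle)) ?_ ?_ ?_ ?_ ?_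
  · exact Submodule.inclusion_injective _
  · intro f
    change ρ (j f) = 0 ↔ _
    rw [hρ]
    constructor
    · intro hf
      refine ⟨⟨f.1, mem_H0_iff.mpr fun y => ?_⟩, rfl⟩
      by_cases hy : y = x
      · subst hy
        exact hf
      · rw [← hoff y hy]
        exact mem_H0_iff.mp f.2 y
    · rintro ⟨g, rfl⟩
      exact mem_H0_iff.mp g.2 x
  · intro c
    change σ (sec c) = 0 ↔ _
    rw [hσ, hsec']
    rfl
  · intro w
    obtain ⟨r, rfl⟩ := Submodule.Quotient.mk_surjective _ w
    rw [show Submodule.factor (submoduleOf_mono hle) (Submodule.Quotient.mk r) =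
      (Submodule.Quotient.mk r : H1 D') from rfl, mk_H1_eq_zero_iff]
    constructor
    · rintro ⟨g, hg⟩
      refine ⟨ρ ⟨r.1 x - g, hg x⟩, ?_⟩
      change σ (sec _) = _
      rw [hσsec, eq_comm, ← sub_eq_zero]
      refine (mk_H1_eq_zero_iff _).mpr ⟨g, fun y => ?_⟩
      change r.1 y - (Pi.single x (r.1 x - g) : C.ClosedPoint → C.K) y - g ∈ localSections D y
      by_cases hy : y = x
      · subst hy
        rw [Pi.single_eq_same, sub_sub_cancel, sub_self]
        exact zero_mem _
      · rw [Pi.single_eq_of_ne hy, sub_zero, ← hoff y hy]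
        exact hg y
    · rintro ⟨c, hc⟩
      have hc' := sub_eq_zero.mpr hc.symm
      obtain ⟨g, hg⟩ := (mk_H1_eq_zero_iff _).mp hc'
      refine ⟨g, fun y => ?_⟩
      have h1 := hg y
      change r.1 y - (Pi.single x (sec c).1 : C.ClosedPoint → C.K) y - g ∈ localSections D y at h1
      by_cases hy : y = x
      · subst hy
        rw [Pi.single_eq_same] at h1
        have h2 := add_mem (localSections_mono (hle y) h1) (sec c).2
        convert h2 using 1
        ring
      · rw [Pi.single_eq_of_ne hy, sub_zero, ← hoff y hy] at h1
        exact h1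
  · exact Submodule.factor_surjective _

instance finite_H0 (D : C.Divisor) : Module.Finite k (H0 D) :=
  Divisor.induction_step (P := fun D => Module.Finite k (H0 D))
    (fun D x => (finrank_add_single D x).1) finite_H0_zero D

/-- H¹ vanishes for the divisor `E` of `exists_adeles_le`, and adding or removing points preserves
finiteness. -/
instance finite_H1 (D : C.Divisor) : Module.Finite k (H1 D) := by
  obtain ⟨E, hE⟩ := exists_adeles_le (C := C)
  have h0 : Module.Finite k (H1 E) := by
    have h : (adelesOf E ⊔ principalAdeles C).submoduleOf (adeles C) = ⊤ :=
      Submodule.submoduleOf_eq_top.mpr hE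
    have : Subsingleton (H1 E) := Submodule.Quotient.subsingleton_iff.mpr h
    infer_instance
  exact Divisor.induction_step (P := fun D => Module.Finite k (H1 D))
    (fun D x => (finrank_add_single D x).2.1) h0 D

/-- The theorem of Riemann and Roch, in terms of the first cohomology group. -/
theorem riemannRoch (D : C.Divisor) :
    (h0 D : ℤ) - Module.finrank k (H1 D) = D.deg + h0 (0 : C.Divisor) - C.genus := by
  let P : C.Divisor → Prop := fun D =>
    (Module.finrank k (H0 D) : ℤ) - Module.finrank k (H1 D) =
      D.deg + Module.finrank k (H0 (0 : C.Divisor)) - Module.finrank k (H1 (0 : C.Divisor))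
  have hP : ∀ D x, P D ↔ P (D + Finsupp.single x 1) := by
    intro D x
    have h := (finrank_add_single D x).2.2 inferInstance inferInstance
    simp only [P, Divisor.deg_add, Divisor.deg_single, h]
    constructor <;> intro h' <;> linarith
  have hP0 : P 0 := by simp only [P, Divisor.deg_zero, zero_add]
  exact Divisor.induction_step hP hP0 D

/-- Multiplication `H⁰(F) × H¹(D) → H¹(D + F)`, with `H¹(D)` represented by adeles. -/
def mulAdele (D F : C.Divisor) : H0 F →ₗ[k] adeles C →ₗ[k] H1 (D + F) :=
  LinearMap.mk₂ k (fun f r => Submodule.Quotient.mk ⟨f.1 • r.1, smul_mem_adeles f.1 r.2⟩)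
    (fun f g r => by
      rw [← Submodule.Quotient.mk_add]
      exact congrArg _ (Subtype.ext (add_smul f.1 g.1 r.1)))
    (fun c f r => by
      rw [← Submodule.Quotient.mk_smul]
      exact congrArg _ (Subtype.ext (smul_assoc c f.1 r.1)))
    (fun f r s => by
      rw [← Submodule.Quotient.mk_add]
      exact congrArg _ (Subtype.ext (smul_add f.1 r.1 s.1)))
    (fun c f r => by
      rw [← Submodule.Quotient.mk_smul]
      exact congrArg _ (Subtype.ext (smul_comm f.1 c r.1)))

theorem mulAdele_apply (D F : C.Divisor) (f : H0 F) (r : adeles C) :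
    mulAdele D F f r = Submodule.Quotient.mk ⟨f.1 • r.1, smul_mem_adeles f.1 r.2⟩ := rfl

theorem le_ker_mulAdele (D F : C.Divisor) (f : H0 F) :
    (adelesOf D ⊔ principalAdeles C).submoduleOf (adeles C) ≤ LinearMap.ker (mulAdele D F f) := by
  intro r hr
  obtain ⟨g, hg⟩ := (mk_H1_eq_zero_iff r).mp ((Submodule.Quotient.mk_eq_zero _).mpr hr)
  rw [LinearMap.mem_ker, mulAdele_apply, mk_H1_eq_zero_iff]
  refine ⟨f.1 * g, fun x => ?_⟩
  change f.1 * r.1 x - f.1 * g ∈ _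
  rw [← mul_sub, mul_comm]
  exact mul_mem_localSections (hg x) (mem_H0_iff.mp f.2 x)

/-- An adele divided by a nonzero rational function is again an adele. Both vanishing theorems below
rest on this. -/
theorem mulAdele_surjective (D F : C.Divisor) {f : H0 F} (hf : f ≠ 0) :
    Function.Surjective (mulAdele D F f) := by
  intro w
  obtain ⟨r, rfl⟩ := Submodule.Quotient.mk_surjective _ w
  refine ⟨⟨f.1⁻¹ • r.1, smul_mem_adeles _ r.2⟩, ?_⟩
  rw [mulAdele_apply]
  refine congrArg _ (Subtype.ext ?_)
  exact smul_inv_smul₀ (fun h => hf (Subtype.ext h)) r.1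

/-- Multiplication by a nonzero section embeds H⁰(0) into H⁰(F) and maps H¹(0) onto H¹(F). The Euler
characteristic of F would then be at least that of 0, against Riemann–Roch. -/
theorem H0_eq_bot_of_deg_neg {F : C.Divisor} (hF : F.deg < 0) : H0 F = ⊥ := by
  by_contra hne
  obtain ⟨f, hf, hf0⟩ := Submodule.exists_mem_ne_zero_of_ne_bot hne
  have h1 : Module.finrank k (H1 (0 + F)) ≤ Module.finrank k (H1 (0 : C.Divisor)) :=
    LinearMap.finrank_le_finrank_of_surjective
      (f := Submodule.liftQ _ (mulAdele 0 F ⟨f, hf⟩) (le_ker_mulAdele 0 F ⟨f, hf⟩)) fun w => by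
        obtain ⟨r, hr⟩ := mulAdele_surjective 0 F (f := ⟨f, hf⟩)
          (fun h => hf0 (congrArg Subtype.val h)) w
        exact ⟨Submodule.Quotient.mk r, hr⟩
  have h2 : h0 (0 : C.Divisor) ≤ h0 (0 + F) := by
    let φ : H0 (0 : C.Divisor) →ₗ[k] H0 (0 + F) :=
      LinearMap.restrict (LinearMap.mulRight k f) fun g hg => mul_mem_H0 hg hf
    refine LinearMap.finrank_le_finrank_of_injective (f := φ) fun g g' h => ?_
    exact Subtype.ext (mul_right_cancel₀ hf0 (congrArg Subtype.val h))
  have h3 := riemannRoch (0 + F)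
  have h4 := riemannRoch (0 : C.Divisor)
  rw [Divisor.deg_add, Divisor.deg_zero] at h3
  rw [Divisor.deg_zero] at h4
  omega

/-- A nonzero functional ω on H¹(D) would embed H⁰(D) into the dual of H¹(0) by f ↦ ω(f ·),
injectively because multiplication by f ≠ 0 maps H¹(0) onto H¹(D). Hence h⁰(D) ≤ g, while
Riemann–Roch with h⁰(0) ≥ 1 and h¹(D) ≥ 1 gives h⁰(D) ≥ g + 1. -/
theorem subsingleton_H1 {D : C.Divisor} (hD : 2 * (C.genus : ℤ) - 2 < D.deg) :
    Subsingleton (H1 D) := by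
  by_contra hns
  rw [not_subsingleton_iff_nontrivial] at hns
  have hpos : 0 < Module.finrank k (H1 D) := Module.finrank_pos
  rw [← zero_add D] at hns
  obtain ⟨w, hw⟩ := exists_ne (0 : H1 (0 + D))
  obtain ⟨ω, hω⟩ : ∃ ω : Module.Dual k (H1 (0 + D)), ω w ≠ 0 := by
    by_contra! h
    exact hw ((Module.forall_dual_apply_eq_zero_iff k w).mp h)
  let Φ : H0 D →ₗ[k] Module.Dual k (H1 (0 : C.Divisor)) :=
    { toFun := fun f => Submodule.liftQ _ (ω ∘ₗ mulAdele 0 D f) fun r hr => by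
        have := le_ker_mulAdele 0 D f hr
        rw [LinearMap.mem_ker] at this ⊢
        rw [LinearMap.comp_apply, this, map_zero]
      map_add' := fun f g => by
        ext r
        simp
      map_smul' := fun c f => by
        ext r
        simp }
  have hΦ : Function.Injective Φ := by
    rw [injective_iff_map_eq_zero]
    intro f hf
    by_contra hf0
    obtain ⟨r, rfl⟩ := mulAdele_surjective 0 D hf0 w
    exact hω (LinearMap.congr_fun hf (Submodule.Quotient.mk r))
  have h1 := LinearMap.finrank_le_finrank_of_injective hΦ
  rw [Subspace.dual_finrank_eq] at h1
  have h2 := riemannRoch D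
  have h3 : 0 < h0 (0 : C.Divisor) := by
    have : Nontrivial (H0 (0 : C.Divisor)) :=
      ⟨⟨1, one_mem_H0⟩, 0, fun h => one_ne_zero (congrArg Subtype.val h)⟩
    exact Module.finrank_pos
  change h0 D ≤ C.genus at h1
  omega

end SmoothProjectiveCurve

/-! ### Functionals with minimal subscheme Z and the choice of s -/

theorem LinearMap.exists_dual_comp_of_ker_le {k V ι : Type*} {M : ι → Type*} [Field k]
    [AddCommGroup V] [Module k V] [∀ i, AddCommGroup (M i)] [∀ i, Module k (M i)]
    {f : V →ₗ[k] ∀ i, M i} {α : Module.Dual k V} (h : ∀ v, f v = 0 → α v = 0) :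
    ∃ β : Module.Dual k (∀ i, M i), α = β ∘ₗ f := by
  obtain ⟨β, hβ⟩ := (LinearMap.range_dualMap_eq_dualAnnihilator_ker f).ge
    ((Submodule.mem_dualAnnihilator α).mpr h)
  exact ⟨β, hβ.symm⟩

namespace SmoothProjectiveCurve

variable {k : Type u} [Field k] {C : SmoothProjectiveCurve k}

theorem Psi_eq_mul_sum_lastCoeff {n m : ℕ} (a : (Fin (m + 1 + 1) → Fin (n + 1)) → k)
    (j : Fin (n + 1)) (x : Fin (m + 1) → Fin (n + 1) → C.K) :
    Psi a j x = ((m + 2).factorial : C.K) *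
      ∑ J, algebraMap k C.K (lastCoeff a j J) * ∏ i, x i (J i) := by
  unfold Psi
  refine congrArg _ (Finset.sum_congr rfl fun J _ => ?_)
  refine congrArg (fun c => algebraMap k C.K c * _) (congrArg a ?_)
  ext i
  refine Fin.lastCases ?_ (fun i => ?_) i
  · simp
  · simp [Nat.lt_succ_iff.mp i.2]

variable [Finite k]

theorem restrict_eq_zero_iff {D Z : C.Divisor} (f : H0 D) :
    restrict D Z f = 0 ↔ (f : C.K) ∈ H0 (D - Z) := by
  rw [mem_H0_iff, funext_iff]
  refine forall_congr' fun x => ?_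
  change (Submodule.Quotient.mk _ : localSections D x ⧸ _) = 0 ↔ _
  rw [Submodule.Quotient.mk_eq_zero]
  rfl

/-- The kernel of restriction to Z is H⁰(D - Z), and a functional on the image of the restriction
map extends to the whole space. -/
theorem factorsThrough_iff {D Z : C.Divisor} {α : Module.Dual k (H0 D)} :
    FactorsThrough α Z ↔ ∀ f : H0 D, (f : C.K) ∈ H0 (D - Z) → α f = 0 := by
  constructor
  · rintro ⟨β, rfl⟩ f hf
    rw [LinearMap.comp_apply, (restrict_eq_zero_iff f).mpr hf, map_zero]
  · intro h
    exact LinearMap.exists_dual_comp_of_ker_le (M := fun x => localSections D x ⧸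
      (localSections (D - Z) x).submoduleOf (localSections D x)) (f := restrict D Z)
      fun f hf => h f ((restrict_eq_zero_iff f).mp hf)

/-- Prescribing the section of a divisor of large degree modulo an effective divisor. -/
theorem exists_interpolation {E Z : C.Divisor} (hZ : 0 ≤ Z)
    (hE : 2 * (C.genus : ℤ) - 2 < (E - Z).deg) {r : C.ClosedPoint → C.K} (hr : r ∈ adelesOf E) :
    ∃ y ∈ H0 E, ∀ x, r x - y ∈ localSections (E - Z) x := by
  have := subsingleton_H1 hE
  obtain ⟨y, hy⟩ := (mk_H1_eq_zero_iff (D := E - Z) ⟨r, adelesOf_le_adeles E hr⟩).mp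
    (Subsingleton.elim _ _)
  refine ⟨y, mem_H0_iff.mpr fun x => ?_, hy⟩
  have h1 : (E - Z) x ≤ E x := by
    rw [Finsupp.sub_apply]
    linarith [show 0 ≤ Z x from hZ x]
  have h2 := sub_mem (mem_adelesOf.mp hr x) (localSections_mono h1 (hy x))
  rwa [sub_sub_cancel] at h2

/-- A section `u` such that a functional with minimal subscheme `Z` annihilates the multiples
of `u` vanishes along `Z`, hence is zero if its degree is smaller than that of `Z`. -/
theorem eq_zero_of_forall_mul_eq_zero {G E F Z : C.Divisor} (hG : F + E = G)
    {α : Module.Dual k (H0 G)} (hα : FactorsMinimally α Z)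
    (hE : 2 * (C.genus : ℤ) - 2 < (E - Z).deg) (hF : (F - Z).deg < 0) {u : C.K} (hu : u ∈ H0 F)
    (h : ∀ y ∈ H0 E, ∀ huy : u * y ∈ H0 G, α ⟨u * y, huy⟩ = 0) : u = 0 := by
  subst hG
  by_contra hu0
  obtain ⟨hZ, hαZ, hmin⟩ := hα
  have hord : ∀ x : C.ClosedPoint, 0 ≤ C.X.ord u x.1 + F x := fun x =>
    (mem_H0_iff.mp hu x).resolve_left hu0
  have hZ' : ∀ x, 0 ≤ Z x := fun x => hZ x
  have hsupp : (Function.support fun x : C.ClosedPoint =>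
      min (C.X.ord u x.1 + F x) (Z x)).Finite := by
    refine Z.support.finite_toSet.subset fun x hx => ?_
    rw [Finset.mem_coe, Finsupp.mem_support_iff]
    intro h0
    refine hx ?_
    change min (C.X.ord u x.1 + F x) (Z x) = 0
    rw [h0, min_eq_right (hord x)]
  -- `W` is the intersection of Z with the zero divisor of u as a section of 𝒪(F).
  let W : C.Divisor := Finsupp.ofSupportFinite _ hsupp
  have hW : ∀ x, W x = min (C.X.ord u x.1 + F x) (Z x) := fun x => rfl
  have hW0 : 0 ≤ W := fun x => le_min (hord x) (hZ' x)
  have hWZ : W ≤ Z := fun x => min_le_right _ _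
  have hαW : FactorsThrough α W := by
    rw [factorsThrough_iff]
    intro f hf
    -- Local quotients to interpolate. Where u vanishes less than Z requires, f/u is a local section
    -- of 𝒪(E). Elsewhere W = Z locally, so f and all multiples uy already vanish modulo Z, and 0
    -- will do.
    let r : C.ClosedPoint → C.K := fun x =>
      if Z x ≤ C.X.ord u x.1 + F x then 0 else (f : C.K) / u
    have hr : r ∈ adelesOf E := by
      refine mem_adelesOf.mpr fun x => ?_
      by_cases hx : Z x ≤ C.X.ord u x.1 + F x
      · simp only [r, if_pos hx]
        exact zero_mem _
      · simp only [r, if_neg hx]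
        have h1 : u⁻¹ ∈ localSections (W - F) x := by
          refine mem_localSections_iff.mpr (Or.inr ?_)
          rw [ord_inv, Finsupp.sub_apply, hW, min_eq_left (by omega)]
          omega
        have h2 := mul_mem_localSections (mem_H0_iff.mp hf x) h1
        rw [div_eq_mul_inv]
        convert h2 using 2
        abel
    obtain ⟨y, hy, hry⟩ := exists_interpolation hZ hE hr
    have huy := mul_mem_H0 hu hy
    have hsub : (f : C.K) - u * y ∈ H0 (F + E - Z) := by
      refine mem_H0_iff.mpr fun x => ?_
      have h1 := mul_mem_localSections (mem_H0_iff.mp hu x) (hry x)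
      rw [← add_sub_assoc] at h1
      by_cases hx : Z x ≤ C.X.ord u x.1 + F x
      · simp only [r, if_pos hx] at h1
        have h2 : (f : C.K) ∈ localSections (F + E - Z) x := by
          rw [← localSections_congr (D := F + E - W)]
          · exact mem_H0_iff.mp hf x
          · rw [Finsupp.sub_apply, Finsupp.sub_apply, hW, min_eq_right hx]
        have h3 := add_mem h2 h1
        convert h3 using 1
        ring
      · simp only [r, if_neg hx] at h1
        convert h1 using 1
        field_simp
    have h1 := factorsThrough_iff.mp hαZ (f - ⟨u * y, huy⟩) hsub
    rwa [map_sub, h y hy huy, sub_zero] at h1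
  have hWeq : W = Z := by
    by_contra hne
    exact hmin W hW0 (lt_of_le_of_ne hWZ hne) hαW
  have huZ : u ∈ H0 (F - Z) := by
    refine mem_H0_iff.mpr fun x => mem_localSections_iff.mpr (Or.inr ?_)
    have h1 := hW x
    rw [hWeq] at h1
    have h2 := h1.le.trans (min_le_left _ _)
    rw [Finsupp.sub_apply]
    linarith
  rw [H0_eq_bot_of_deg_neg hF] at huZ
  exact hu0 huZ

/-- The final `+ 1` turns the floors into strict bounds, and clearing the denominator d - 1 = m + 1
yields exactly deg(E - Z) > 2g - 2 and deg(F - Z) < 0 at a point ∞ of degree one. -/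
theorem lt_shrinkingParameter (m : ℕ) (e g z : ℤ) :
    z - e + 2 * g - 2 < (m + 1) * shrinkingParameter (m + 2) e g z ∧
      (m + 1) * e - z < (m + 1) * shrinkingParameter (m + 2) e g z := by
  have hm : (0 : ℚ) < ((m + 2 : ℕ) : ℚ) - 1 := by
    push_cast
    linarith [(Nat.cast_nonneg m : (0 : ℚ) ≤ m)]
  have hm' : (((m + 2 : ℕ) : ℚ) - 1) = m + 1 := by push_cast; ring
  have key : ∀ q : ℚ, ⌊q⌋ + 1 ≤ shrinkingParameter (m + 2) e g z →
      (m + 1) * q < (m + 1) * shrinkingParameter (m + 2) e g z := fun q hq => by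
    refine mul_lt_mul_of_pos_left ?_ (hm' ▸ hm)
    refine (Int.lt_floor_add_one q).trans_le ?_
    exact_mod_cast hq
  have h1 := key _ (add_le_add_left ((le_max_left _ _).trans (le_max_left _ _)) 1)
  have h2 := key _ (add_le_add_left ((le_max_right _ _).trans (le_max_left _ _)) 1)
  rw [← hm', mul_div_cancel₀ _ hm.ne', hm'] at h1
  rw [← hm', mul_sub, mul_div_cancel₀ _ hm.ne', hm'] at h2
  exact ⟨by exact_mod_cast h1, by exact_mod_cast h2⟩

end SmoothProjectiveCurve

end

/-! ### The counting bound -/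

theorem proposition8 (d n : ℕ) (hd : 2 ≤ d) :
    ∃ c : ℝ, ∀ (k : Type u) [Field k] [Fintype k] (p : ℕ) [CharP k p] (_ : d < p)
      (C : SmoothProjectiveCurve k) (infty : C.ClosedPoint) (_ : C.pointDegree infty = 1)
      (D : C.Divisor)
      (f : MvPolynomial (Fin (n + 1)) k) (_ : IsSmoothHypersurface f d)
      (a : (Fin d → Fin (n + 1)) → k) (_ : IsSymmetricCoefficients f a)
      (α : Module.Dual k (SmoothProjectiveCurve.H0 (d • D)))
      (Z : C.Divisor) (_ : SmoothProjectiveCurve.FactorsMinimally α Z)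
      (s : ℤ) (_ : s = SmoothProjectiveCurve.shrinkingParameter d D.deg C.genus Z.deg),
      (SmoothProjectiveCurve.countN (one_le_two.trans hd) a D infty s α : ℝ) ≤
        c * (Fintype.card k : ℝ) ^
          ((d - 2) * (n + 1) * SmoothProjectiveCurve.h0 (D - Finsupp.single infty s)) := by
  obtain ⟨m, rfl⟩ := Nat.exists_eq_add_of_le' hd
  refine ⟨((((n + 1) * (m + 1) + 1) ^ (n + 1)) ^ (n + 1) : ℕ), ?_⟩
  intro k _ _ p _ hp C infty hinfty D f hf a ha α Z hZ s hs
  have hprime : p.Prime := CharP.char_is_prime k p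
  have hfact : ((m + 2).factorial : C.K) ≠ 0 := by
    rw [← map_natCast (algebraMap k C.K), Ne, map_eq_zero, CharP.cast_eq_zero_iff k p,
      hprime.dvd_factorial]
    omega
  have hdeg : ((m + 1 + 1 : ℕ) : k) ≠ 0 := by
    rw [Ne, CharP.cast_eq_zero_iff k p]
    exact fun h => absurd (Nat.le_of_dvd (by omega) h) (by omega)
  let V := SmoothProjectiveCurve.H0 (D - Finsupp.single infty s)
  have : Finite V := Module.finite_of_finite k
  obtain ⟨hs1, hs2⟩ := SmoothProjectiveCurve.lt_shrinkingParameter m D.deg C.genus Z.deg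
  -- Every counted tuple makes all Ψ_j vanish identically; dividing by d! leaves a zero of the
  -- multilinear system with entries in `V`.
  have hinj : SmoothProjectiveCurve.countN (one_le_two.trans hd) a D infty s α ≤
      Nat.card {x : Fin (m + 1) → Fin (n + 1) → V // ∀ j,
        ∑ J, algebraMap k C.K (lastCoeff a j J) * ∏ i, (x i (J i) : C.K) = 0} := by
    refine Nat.card_le_card_of_injective (fun x => ⟨x.1, fun j => ?_⟩) fun x y hxy =>
      Subtype.ext (congrArg Subtype.val hxy :)
    refine (mul_eq_zero.mp ?_).resolve_left hfact
    refine (SmoothProjectiveCurve.Psi_eq_mul_sum_lastCoeff a j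
      fun i l => (x.1 i l : C.K)).symm.trans ?_
    refine SmoothProjectiveCurve.eq_zero_of_forall_mul_eq_zero
      (E := D + (m + 1) • Finsupp.single infty s) (F := (m + 1) • (D - Finsupp.single infty s))
      ?_ hZ ?_ ?_ (SmoothProjectiveCurve.Psi_mem_H0 a j x.1) fun y hy _ => x.2 j ⟨y, hy⟩
    · rw [smul_sub, sub_add_add_cancel, ← succ_nsmul]
    · rw [SmoothProjectiveCurve.Divisor.deg_sub, SmoothProjectiveCurve.Divisor.deg_add,
        SmoothProjectiveCurve.Divisor.deg_nsmul, SmoothProjectiveCurve.Divisor.deg_single, hinfty, hs]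
      push_cast
      linarith
    · rw [SmoothProjectiveCurve.Divisor.deg_sub, SmoothProjectiveCurve.Divisor.deg_nsmul,
        SmoothProjectiveCurve.Divisor.deg_sub, SmoothProjectiveCurve.Divisor.deg_single, hinfty, hs]
      push_cast
      linarith
  have hcard := card_multilinear_zeros_le (K := C.K) (X_mem_radical_span_diagForm ha hf hdeg) V
  have hV : Nat.card V = Fintype.card k ^ SmoothProjectiveCurve.h0 (D - Finsupp.single infty s) := by
    rw [← Nat.card_eq_fintype_card]
    exact Module.natCard_eq_pow_finrank (K := k)
  rw [hV, ← pow_mul (Fintype.card k)] at hcard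
  have := hinj.trans hcard
  rw [Nat.add_sub_cancel, mul_comm (m * (n + 1))]
  exact_mod_cast this
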